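/- Notation. Let $k\ge 1$ be an integer, $\varrho\in\mathbb H$, $\eta=\operatorname{Im}\varrho$, $z=x+iy\in\mathbb H$, $X_\varrho(z)=\frac{z-\varrho}{z-\overline\varrho}$ and $r_\varrho(z)=|X_\varrho(z)|$. Put $$\Delta_{2-2k}=-y^2\left(\tfrac{\partial^2}{\partial x^2}+\tfrac{\partial^2}{\partial y^2}\right)+2i(1-k)y\left(\tfrac{\partial}{\partial x}+i\tfrac{\partial}{\partial y}\right),\qquad \xi_{2-2k}=2iy^{2-2k}\,\overline{\tfrac{\partial}{\partial\overline z}},\qquad D^{2k-1}=\left(\tfrac1{2\pi i}\tfrac{\partial}{\partial z}\right)^{2k-1}.$$ For $0\le Z<1$, $a\in\mathbb N$, $b\in\mathbb Z$ let $$\beta(Z;a,b)=\int_0^Z t^{a-1}(1-t)^{b-1}\,dt,\qquad \beta_0(Z;a,b)=\beta(Z;a,b)-\sum_{\substack{0\le j\le a-1\\ j\ne -b}}\binom{a-1}{j}\frac{(-1)^j}{j+b}.$$ Proposition. Let $n_0\ge 0$ be an integer, $n_k=\min(2k-2,n_0)$, $R>0$ and $U=\{z\in\mathbb H: z\neq\varrho,\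 r_\varrho(z)<R\}$. Let $F:\mathbb H\to\mathbb C$ be twice continuously differentiable on $U$ with $\Delta_{2-2k}(F)=0$ on $U$, and suppose that $r_\varrho^{n_0}F$ is bounded near $\varrho$ (off $\varrho$). Then there are $c^{\pm}(n)=c^\pm_{F,\varrho}(n)\in\mathbb C$ such that for all $z\in U$, with absolutely convergent series, $$F(z)=(z-\overline\varrho)^{2k-2}\Bigg(\sum_{n\ge -n_0}c^+(n)X_\varrho^n(z)+\sum_{n=0}^{n_k}c^-(n)\beta\left(1-r_\varrho^2(z);2k-1,-n\right)X_\varrho^n(z)+\sum_{\substack{n\le n_0\\ n\notin[0,n_k]}}c^-(n)\beta_0\left(1-r_\varrho^2(z);2k-1,-n\right)X_\varrho^n(z)\Bigg).\qquad(*)$$ Moreover, for all $c^\pm(n)$ for which $(*)$ holds on $U$ with absolutely convergent series, $F$ is smooth on $U$, and for all $z\in U$, with absolutely convergent series, $$\xi_{2-2k}(F)(z)=(4\eta)^{2k-1}(z-\overline\varrho)^{-2k}\sum_{n\le n_0}\overline{c^-(n)}\,X_\varrho^{-n-1}(z),$$ $$D^{2k-1}(F)(z)=\left(\frac{\eta}{\pi}\right)^{2k-1}(z-\overline\varrho)^{-2k}\sum_{n\ge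 -n_0}b(n)X_\varrho^{n+1-2k}(z),$$ where $$b(n)=\begin{cases}-\dfrac{(-n+2k-2)!}{(-n-1)!}\,c^+(n)&\text{if } n<0,\\[2mm] -(2k-2)!\,c^-(n)&\text{if } 0\le n\le n_k,\\[1mm] \dfrac{n!}{(n+1-2k)!}\,c^+(n)&\text{if } n\ge 2k-1,\end{cases}$$ and $b(n)=0$ for $n_k<n\le 2k-2$ (such $n$ exist only if $n_0<2k-2$). -/

import Mathlib

open scoped UpperHalfPlane ComplexConjugate Topology ContDiff

namespace PolarMaass

noncomputable section

/-- `∂f/∂x` for a function on the upper half-plane, `z = x + iy`. -/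
def partialX (f : ℍ → ℂ) (z : ℍ) : ℂ :=
  fderiv ℝ (f ∘ UpperHalfPlane.ofComplex) (z : ℂ) 1

/-- `∂f/∂y` for a function on the upper half-plane, `z = x + iy`. -/
def partialY (f : ℍ → ℂ) (z : ℍ) : ℂ :=
  fderiv ℝ (f ∘ UpperHalfPlane.ofComplex) (z : ℂ) Complex.I

/-- The Wirtinger derivative `∂/∂z = (∂/∂x - i ∂/∂y) / 2`. -/
def partialZ (f : ℍ → ℂ) (z : ℍ) : ℂ :=
  (partialX f z - Complex.I * partialY f z) / 2

/-- The Wirtinger derivative `∂/∂z̄ = (∂/∂x + i ∂/∂y) / 2`. -/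
def partialZBar (f : ℍ → ℂ) (z : ℍ) : ℂ :=
  (partialX f z + Complex.I * partialY f z) / 2

/-- The weight `2κ` hyperbolic Laplace operator
`Δ_{2κ} = -y² (∂²/∂x² + ∂²/∂y²) + 2iκy (∂/∂x + i ∂/∂y)`. -/
def hypLaplacian (κ : ℤ) (f : ℍ → ℂ) (z : ℍ) : ℂ :=
  -(z.im : ℂ) ^ 2 * (partialX (partialX f) z + partialY (partialY f) z)
    + 2 * Complex.I * (κ : ℂ) * (z.im : ℂ) * (partialX f z + Complex.I * partialY f z)

/-- The operator `ξ_{2κ} f = 2i y^{2κ} conj (∂f/∂z̄)`. -/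
def xi (κ : ℤ) (f : ℍ → ℂ) (z : ℍ) : ℂ :=
  2 * Complex.I * (z.im : ℂ) ^ (2 * κ) * conj (partialZBar f z)

/-- The operator `D^m`, the `m`-fold iterate of `D = (1 / (2πi)) ∂/∂z`. -/
def iterD (m : ℕ) (f : ℍ → ℂ) : ℍ → ℂ :=
  (fun (g : ℍ → ℂ) (z : ℍ) => 1 / (2 * (Real.pi : ℂ) * Complex.I) * partialZ g z)^[m] f

/-- `f` is twice continuously differentiable on (a neighbourhood of each point of) `U` and is
annihilated there by `Δ_{2κ}`. -/
def IsHarmonicOn (κ : ℤ) (f : ℍ → ℂ) (U : Set ℍ) : Prop :=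
  ∀ z ∈ U, ContDiffAt ℝ 2 (f ∘ UpperHalfPlane.ofComplex) (z : ℂ) ∧ hypLaplacian κ f z = 0

/-- `X_ϱ(z) = (z - ϱ) / (z - ϱ̄)`. -/
def ellX (ϱ z : ℍ) : ℂ := ((z : ℂ) - (ϱ : ℂ)) / ((z : ℂ) - conj (ϱ : ℂ))

/-- `r_ϱ(z) = |X_ϱ(z)|`, the hyperbolic tangent of half the hyperbolic distance of `z` and `ϱ`. -/
def ellR (ϱ z : ℍ) : ℝ := ‖ellX ϱ z‖

/-- The hyperbolic disc `r_ϱ(z) < R` without its centre `ϱ`; it is all of `ℍ \ {ϱ}` if `1 ≤ R`. -/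
def puncturedDisc (ϱ : ℍ) (R : ℝ) : Set ℍ := {z | z ≠ ϱ ∧ ellR ϱ z < R}

/-- The incomplete beta function `β(Z; a, b) = ∫₀^Z t^{a-1} (1-t)^{b-1} dt`, for `0 ≤ Z < 1`,
`a ≥ 1` and an arbitrary integer `b`. -/
def incBeta (Z : ℝ) (a : ℕ) (b : ℤ) : ℝ :=
  ∫ t in (0 : ℝ)..Z, t ^ (a - 1) * (1 - t) ^ (b - 1)

/-- The constant `C_{a,b} = ∑_{0 ≤ j ≤ a-1, j ≠ -b} binom(a-1, j) (-1)^j / (j+b)`, for `a ≥ 1`. -/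
def betaConst (a : ℕ) (b : ℤ) : ℝ :=
  ∑ j ∈ (Finset.range a).filter (fun j : ℕ => (j : ℤ) ≠ -b),
    ((a - 1).choose j : ℝ) * ((-1 : ℝ) ^ j / ((j : ℝ) + (b : ℝ)))

/-- The modified incomplete beta function `β₀(Z; a, b) = β(Z; a, b) - C_{a,b}`. -/
def incBetaZero (Z : ℝ) (a : ℕ) (b : ℤ) : ℝ := incBeta Z a b - betaConst a b

/-- `n_k = min (2k-2, n₀)`, as an integer. -/
def nK (k n₀ : ℕ) : ℤ := min (2 * (k : ℤ) - 2) (n₀ : ℤ)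

/-- The indices of the series with `β₀` in the elliptic expansion: `n ≤ n₀` and `n ∉ [0, n_k]`. -/
def betaZeroIndices (k n₀ : ℕ) : Set ℤ := {n | n ≤ (n₀ : ℤ) ∧ n ∉ Set.Icc (0 : ℤ) (nK k n₀)}

/-- `F` has, at every point of the punctured disc `0 < r_ϱ(z) < R`, the weight `2 - 2k` elliptic
expansion around `ϱ` with coefficients `c⁺(n)` for `n ≥ -n₀` and `c⁻(n)` for `n ≤ n₀`, both
infinite series being (absolutely) convergent. -/
def HasEllipticExpansion (k n₀ : ℕ) (ϱ : ℍ) (R : ℝ) (F : ℍ → ℂ) (cPlus cMinus : ℤ → ℂ) : Prop :=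
  ∀ z ∈ puncturedDisc ϱ R,
    Summable (fun n : Set.Ici (-(n₀ : ℤ)) => cPlus n * ellX ϱ z ^ (n : ℤ)) ∧
    Summable (fun n : betaZeroIndices k n₀ =>
      cMinus n * (incBetaZero (1 - ellR ϱ z ^ 2) (2 * k - 1) (-(n : ℤ)) : ℂ)
        * ellX ϱ z ^ (n : ℤ)) ∧
    F z = ((z : ℂ) - conj (ϱ : ℂ)) ^ (2 * k - 2) *
      ((∑' n : Set.Ici (-(n₀ : ℤ)), cPlus n * ellX ϱ z ^ (n : ℤ))
        + (∑ n ∈ Finset.Icc (0 : ℤ) (nK k n₀),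
            cMinus n * (incBeta (1 - ellR ϱ z ^ 2) (2 * k - 1) (-n) : ℂ) * ellX ϱ z ^ n)
        + ∑' n : betaZeroIndices k n₀,
            cMinus n * (incBetaZero (1 - ellR ϱ z ^ 2) (2 * k - 1) (-(n : ℤ)) : ℂ)
              * ellX ϱ z ^ (n : ℤ))

/-- The coefficients `b(n)` of `D^{2k-1} F`. For `n_k < n ≤ 2k-2` the value is `0`; such `n` exist
only if `n₀ < 2k-2`. -/
def bCoeff (k n₀ : ℕ) (cPlus cMinus : ℤ → ℂ) (n : ℤ) : ℂ :=
  if n < 0 then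
    -((((-n + 2 * (k : ℤ) - 2).toNat.factorial : ℕ) : ℂ)
        / (((-n - 1).toNat.factorial : ℕ) : ℂ)) * cPlus n
  else if n ≤ nK k n₀ then
    -(((2 * k - 2).factorial : ℕ) : ℂ) * cMinus n
  else if 2 * (k : ℤ) - 1 ≤ n then
    ((n.toNat.factorial : ℕ) : ℂ) / (((n + 1 - 2 * (k : ℤ)).toNat.factorial : ℕ) : ℂ) * cPlus n
  else 0

end

end PolarMaass

/-!
Put `X = X_ϱ(z)` and write `F(z) = (z - ϱ̄) ^ (2k - 2) H(X)`. In the disc coordinate, harmonicity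
of weight `2 - 2k` says that `∂H/∂X̄ = -(1 - |X|²) ^ (2k - 2) conj Ψ(X)` with `Ψ` holomorphic on
the punctured disc; up to explicit factors `Ψ` is `ξ F`.

**Existence.** Stokes' theorem on the discs `|v - X| ≤ |X| / 2` bounds `Ψ(X)` by `|X|⁻¹` times a
bound for `H` (`norm_le_of_dzBar_eq_conj_add`, `exists_bound_pole`), so `Ψ` has a pole of order at
most `n₀ + 1` and a Laurent series `∑_{n ≤ n₀} conj (c⁻(n)) X ^ (-n - 1)`. Expanding `(1 - |X|²) ^
(2k - 2)` by the binomial theorem and integrating termwise in `X̄` gives a particular solution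
`nonholPart = ∑_j (-1) ^ j (2k - 2 choose j) X ^ j L_j(X)`, where `∂L_j/∂X̄ = -conj (X ^ j Ψ(X))`;
the function `L_j` is antiholomorphic except for a multiple of `log |X|²` when `X ^ j Ψ` has a
residue. Then `H - nonholPart` is holomorphic with at most a pole of order `n₀`, which supplies
`c⁺` (`exists_disc_expansion`).

**The beta functions.** The same binomial expansion evaluates `β₀` in closed form
(`incBetaZero_eq_sum`), whence `nonholPart = ∑_{n ≤ n₀} c⁻(n) β₀(1 - r²; 2k - 1, -n) X ^ n`
(`hasSum_nonholPart`). Replacing `β₀` by `β` for `0 ≤ n ≤ n_k` changes the sum by a polynomial of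
degree at most `2k - 2`, absorbed into `c⁺`.

**The images under `ξ` and `D^{2k-1}`.** Conversely, convergence of the expansion of `F` forces
convergence of `∑ c⁻(n) X̄ ^ (-n)`, because `|β₀|` is bounded below (`le_neg_incBetaZero`). So `H`
is again a Laurent series plus `nonholPart` plus a polynomial, and `ξ F` is read off from `∂H/∂X̄`.
Bol's identity (`bol_identity`) turns `D^{2k-1}` into the `(2k-1)`-st derivative with respect to
`X`, which is computed termwise on the Laurent series and annihilates all of the rest but the
logarithms (`iterate_dz_nonholPart`): these produce the coefficients `b(n)` with `0 ≤ n ≤ n_k`.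
-/

namespace PolarMaass

/-! ### Wirtinger calculus -/

/-- The real-linear map `v ↦ a v + b v̄`; every real-linear endomorphism of `ℂ` has this form. -/
noncomputable def wirtingerMap (a b : ℂ) : ℂ →L[ℝ] ℂ :=
  a • ContinuousLinearMap.id ℝ ℂ + b • (Complex.conjCLE : ℂ →L[ℝ] ℂ)

@[simp]
theorem wirtingerMap_apply (a b v : ℂ) : wirtingerMap a b v = a * v + b * conj v := by
  simp [wirtingerMap]

/-- `f` is real differentiable at `z` with `∂f/∂z = a` and `∂f/∂z̄ = b`. -/
def HasWirtingerAt (f : ℂ → ℂ) (a b z : ℂ) : Prop := HasFDerivAt f (wirtingerMap a b) z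

/-- The Wirtinger derivative `∂/∂z` for functions on `ℂ`. -/
noncomputable def dz (f : ℂ → ℂ) (z : ℂ) : ℂ :=
  (fderiv ℝ f z 1 - Complex.I * fderiv ℝ f z Complex.I) / 2

/-- The Wirtinger derivative `∂/∂z̄` for functions on `ℂ`. -/
noncomputable def dzBar (f : ℂ → ℂ) (z : ℂ) : ℂ :=
  (fderiv ℝ f z 1 + Complex.I * fderiv ℝ f z Complex.I) / 2

/-- Every real-linear map has the form `v ↦ a v + b v̄`. -/
theorem eq_wirtingerMap (L : ℂ →L[ℝ] ℂ) :
    L = wirtingerMap ((L 1 - Complex.I * L Complex.I) / 2)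
      ((L 1 + Complex.I * L Complex.I) / 2) := by
  ext v
  have hv : L v = v.re * L 1 + v.im * L Complex.I := by
    conv_lhs => rw [show v = v.re • (1 : ℂ) + v.im • Complex.I by
      simp [Complex.re_add_im]]
    rw [map_add, map_smul, map_smul]; simp
  rw [hv, wirtingerMap_apply]
  have h1 : conj v = v.re - v.im * Complex.I := by
    apply Complex.ext <;> simp
  have h2 : v = v.re + v.im * Complex.I := (Complex.re_add_im v).symm
  rw [h1]
  conv_rhs => rw [h2]
  simp only [Complex.add_re, Complex.ofReal_re, Complex.mul_re, Complex.I_re, mul_zero,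
    Complex.ofReal_im, Complex.I_im, mul_one, sub_self, add_zero, Complex.add_im, Complex.mul_im,
    zero_add]
  linear_combination (v.im * L Complex.I) * Complex.I_sq

theorem hasWirtingerAt_of_hasFDerivAt {f : ℂ → ℂ} {L : ℂ →L[ℝ] ℂ} {z : ℂ} (h : HasFDerivAt f L z) :
    HasWirtingerAt f ((L 1 - Complex.I * L Complex.I) / 2) ((L 1 + Complex.I * L Complex.I) / 2) z
        := by
  unfold HasWirtingerAt; rw [← eq_wirtingerMap]; exact h

theorem hasWirtingerAt_dz {f : ℂ → ℂ} {z : ℂ} (h : DifferentiableAt ℝ f z) :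
    HasWirtingerAt f (dz f z) (dzBar f z) z := hasWirtingerAt_of_hasFDerivAt h.hasFDerivAt

namespace HasWirtingerAt

variable {f g : ℂ → ℂ} {a b a' b' z : ℂ}

theorem dz_eq (h : HasWirtingerAt f a b z) : dz f z = a := by
  rw [dz, HasFDerivAt.fderiv h, wirtingerMap_apply, wirtingerMap_apply]
  simp only [map_one, Complex.conj_I]
  linear_combination (-(a - b) / 2) * Complex.I_sq

theorem dzBar_eq (h : HasWirtingerAt f a b z) : dzBar f z = b := by
  rw [dzBar, HasFDerivAt.fderiv h, wirtingerMap_apply, wirtingerMap_apply]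
  simp only [map_one, Complex.conj_I]
  linear_combination ((a - b) / 2) * Complex.I_sq

theorem add (hf : HasWirtingerAt f a b z) (hg : HasWirtingerAt g a' b' z) :
    HasWirtingerAt (fun w => f w + g w) (a + a') (b + b') z := by
  refine (HasFDerivAt.fun_add hf hg).congr_fderiv ?_
  ext v; simp; ring

theorem sub (hf : HasWirtingerAt f a b z) (hg : HasWirtingerAt g a' b' z) :
    HasWirtingerAt (fun w => f w - g w) (a - a') (b - b') z := by
  refine (HasFDerivAt.fun_sub hf hg).congr_fderiv ?_
  ext v; simp; ring

theorem sum {ι : Type*} {s : Finset ι} {f : ι → ℂ → ℂ} {a b : ι → ℂ}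
    (h : ∀ i ∈ s, HasWirtingerAt (f i) (a i) (b i) z) :
    HasWirtingerAt (fun w => ∑ i ∈ s, f i w) (∑ i ∈ s, a i) (∑ i ∈ s, b i) z := by
  refine (HasFDerivAt.fun_sum h).congr_fderiv ?_
  ext v; simp [Finset.sum_add_distrib, Finset.sum_mul]

theorem mul (hf : HasWirtingerAt f a b z) (hg : HasWirtingerAt g a' b' z) :
    HasWirtingerAt (fun w => f w * g w) (a * g z + f z * a') (b * g z + f z * b') z := by
  refine (HasFDerivAt.fun_mul' hf hg).congr_fderiv ?_
  ext v; simp; ring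

theorem const_mul (c : ℂ) (hf : HasWirtingerAt f a b z) :
    HasWirtingerAt (fun w => c * f w) (c * a) (c * b) z := by
  refine (HasFDerivAt.const_mul hf c).congr_fderiv ?_
  ext v; simp; ring

theorem conjugate (hf : HasWirtingerAt f a b z) :
    HasWirtingerAt (fun w => starRingEnd ℂ (f w)) (starRingEnd ℂ b) (starRingEnd ℂ a) z := by
  refine (HasFDerivAt.comp z (Complex.conjCLE.hasFDerivAt (x := f z)) hf).congr_fderiv ?_
  ext v; simp; ring

theorem comp {φ : ℂ → ℂ} {φ' : ℂ} (hf : HasWirtingerAt f a b (φ z)) (hφ : HasDerivAt φ φ' z) :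
    HasWirtingerAt (fun w => f (φ w)) (a * φ') (b * starRingEnd ℂ φ') z := by
  refine (HasFDerivAt.comp z hf (hφ.hasFDerivAt.restrictScalars ℝ)).congr_fderiv ?_
  ext v; simp; ring

theorem of_hasDerivAt (h : HasDerivAt f a z) : HasWirtingerAt f a 0 z := by
  refine (h.hasFDerivAt.restrictScalars ℝ).congr_fderiv ?_
  ext v; simp [mul_comm]

theorem hasDerivAt (h : HasWirtingerAt f a 0 z) : HasDerivAt f a z := by
  rw [hasDerivAt_iff_hasFDerivAt]
  refine hasFDerivAt_of_restrictScalars ℝ h ?_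
  ext v; simp [mul_comm]

theorem congr_of_eventuallyEq (h : HasWirtingerAt f a b z) (hg : g =ᶠ[𝓝 z] f) :
    HasWirtingerAt g a b z := HasFDerivAt.congr_of_eventuallyEq h hg

theorem congr_val (h : HasWirtingerAt f a b z) (ha : a = a') (hb : b = b') :
    HasWirtingerAt f a' b' z := ha ▸ hb ▸ h

/-- Composition of a real-valued function with a differentiable function of a real variable. -/
theorem real_comp {p : ℂ → ℝ} {q : ℝ → ℝ} {q' : ℝ} (hp : HasWirtingerAt (fun w => (p w : ℂ)) a b z)
    (hq : HasDerivAt q q' (p z)) :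
    HasWirtingerAt (fun w => (q (p w) : ℂ)) (q' * a) (q' * b) z := by
  have hp' : HasFDerivAt p (Complex.reCLM.comp (wirtingerMap a b)) z :=
    HasFDerivAt.comp (g := Complex.reCLM) (f := fun w => (p w : ℂ)) z (Complex.reCLM.hasFDerivAt (x
        := (p z : ℂ))) hp
  have huniq : Complex.ofRealCLM.comp (Complex.reCLM.comp (wirtingerMap a b)) = wirtingerMap a b :=
    HasFDerivAt.unique (HasFDerivAt.comp (g := Complex.ofRealCLM) (f := p) z
      (Complex.ofRealCLM.hasFDerivAt (x := p z)) hp') hp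
  refine (HasFDerivAt.comp (g := Complex.ofRealCLM) (f := fun w => q (p w)) z
    (Complex.ofRealCLM.hasFDerivAt (x := q (p z)))
    (hq.comp_hasFDerivAt z hp')).congr_fderiv ?_
  ext v
  have := DFunLike.congr_fun huniq v
  simp only [ContinuousLinearMap.comp_apply, Complex.reCLM_apply, Complex.ofRealCLM_apply,
    smul_apply, wirtingerMap_apply, smul_eq_mul, Complex.ofReal_mul] at this ⊢
  rw [this]; ring

end HasWirtingerAt

theorem hasWirtingerAt_normSq (z : ℂ) :
    HasWirtingerAt (fun w => ((Complex.normSq w : ℝ) : ℂ)) (conj z) z z := by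
  have h := (HasWirtingerAt.of_hasDerivAt (hasDerivAt_id z)).mul
    (HasWirtingerAt.of_hasDerivAt (hasDerivAt_id z)).conjugate
  refine (h.congr_of_eventuallyEq (Filter.Eventually.of_forall fun w => ?_)).congr_val ?_ ?_
  · simp [Complex.mul_conj]
  · simp
  · simp

theorem hasWirtingerAt_im (z : ℂ) :
    HasWirtingerAt (fun w => ((w.im : ℝ) : ℂ)) (1 / (2 * Complex.I)) (-(1 / (2 * Complex.I))) z :=
        by
  have h0 := HasWirtingerAt.of_hasDerivAt (hasDerivAt_id z)
  refine (((h0.sub h0.conjugate).const_mul (1 / (2 * Complex.I))).congr_of_eventuallyEq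
    (Filter.Eventually.of_forall fun w => ?_)).congr_val ?_ ?_
  · simp [Complex.sub_conj]; field_simp; simp [Complex.I_sq]
  · simp
  · simp

/-! ### Iterated Wirtinger derivatives -/

theorem dz_congr_of_eventuallyEq {f g : ℂ → ℂ} {z : ℂ} (h : f =ᶠ[𝓝 z] g) : dz f z = dz g z := by
  simp only [dz, h.fderiv_eq]

theorem dz_eqOn {f g : ℂ → ℂ} {s : Set ℂ} (hs : IsOpen s) (h : Set.EqOn f g s) :
    Set.EqOn (dz f) (dz g) s := fun _ hz =>
  dz_congr_of_eventuallyEq (Filter.eventuallyEq_of_mem (hs.mem_nhds hz) h)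

theorem iterate_dz_eqOn {f g : ℂ → ℂ} {s : Set ℂ} (hs : IsOpen s) (h : Set.EqOn f g s) (m : ℕ) :
    Set.EqOn (dz^[m] f) (dz^[m] g) s := by
  induction m with
  | zero => exact h
  | succ m ih => simpa only [Function.iterate_succ_apply'] using dz_eqOn hs ih

theorem _root_.ContDiffOn.dz {f : ℂ → ℂ} {s : Set ℂ} (hs : IsOpen s) (h : ContDiffOn ℝ ∞ f s) :
    ContDiffOn ℝ ∞ (dz f) s := by
  have h1 := h.fderiv_of_isOpen hs (m := ∞) (by simp)
  unfold PolarMaass.dz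
  exact ((h1.clm_apply contDiffOn_const).sub
    (contDiffOn_const.mul (h1.clm_apply contDiffOn_const))).div_const 2

theorem _root_.ContDiffOn.iterate_dz {f : ℂ → ℂ} {s : Set ℂ} (hs : IsOpen s)
    (h : ContDiffOn ℝ ∞ f s) (m : ℕ) : ContDiffOn ℝ ∞ (PolarMaass.dz^[m] f) s := by
  induction m with
  | zero => exact h
  | succ m ih => simpa only [Function.iterate_succ_apply'] using ih.dz hs

theorem _root_.ContDiffOn.hasWirtingerAt {f : ℂ → ℂ} {s : Set ℂ} (hs : IsOpen s)
    (h : ContDiffOn ℝ ∞ f s) {z : ℂ} (hz : z ∈ s) :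
    HasWirtingerAt f (PolarMaass.dz f z) (dzBar f z) z :=
  hasWirtingerAt_dz ((h.contDiffAt (hs.mem_nhds hz)).differentiableAt (by simp))

theorem contDiffOn_sub_const (s : Set ℂ) (a : ℂ) : ContDiffOn ℝ ∞ (fun z : ℂ => z - a) s :=
  contDiffOn_id.sub contDiffOn_const

section Iterate
variable {f g : ℂ → ℂ} {s : Set ℂ} (hs : IsOpen s)
include hs

theorem iterate_dz_add (hf : ContDiffOn ℝ ∞ f s) (hg : ContDiffOn ℝ ∞ g s) (m : ℕ) :
    Set.EqOn (dz^[m] fun z => f z + g z) (fun z => dz^[m] f z + dz^[m] g z) s := by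
  induction m with
  | zero => exact fun _ _ => rfl
  | succ m ih =>
    intro z hz
    simp only [Function.iterate_succ_apply']
    rw [dz_eqOn hs ih hz]
    exact (((hf.iterate_dz hs m).hasWirtingerAt hs hz).add
      ((hg.iterate_dz hs m).hasWirtingerAt hs hz)).dz_eq

theorem iterate_dz_const_mul (hf : ContDiffOn ℝ ∞ f s) (c : ℂ) (m : ℕ) :
    Set.EqOn (dz^[m] fun z => c * f z) (fun z => c * dz^[m] f z) s := by
  induction m with
  | zero => exact fun _ _ => rfl
  | succ m ih =>
    intro z hz
    simp only [Function.iterate_succ_apply']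
    rw [dz_eqOn hs ih hz]
    exact (((hf.iterate_dz hs m).hasWirtingerAt hs hz).const_mul c).dz_eq

theorem iterate_dz_sum {ι : Type*} (t : Finset ι) {f : ι → ℂ → ℂ}
    (hf : ∀ i ∈ t, ContDiffOn ℝ ∞ (f i) s) (m : ℕ) :
    Set.EqOn (dz^[m] fun z => ∑ i ∈ t, f i z) (fun z => ∑ i ∈ t, dz^[m] (f i) z) s := by
  induction m with
  | zero => exact fun _ _ => rfl
  | succ m ih =>
    intro z hz
    simp only [Function.iterate_succ_apply']
    rw [dz_eqOn hs ih hz]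
    exact (HasWirtingerAt.sum fun i hi => ((hf i hi).iterate_dz hs m).hasWirtingerAt hs hz).dz_eq

/-- Leibniz' rule for a linear factor. -/
theorem iterate_dz_linear_mul (hf : ContDiffOn ℝ ∞ f s) (a : ℂ) (m : ℕ) :
    Set.EqOn (dz^[m + 1] fun z => (z - a) * f z)
      (fun z => (z - a) * dz^[m + 1] f z + (m + 1) * dz^[m] f z) s := by
  have hlin : ∀ z, HasWirtingerAt (fun z : ℂ => z - a) 1 0 z := fun z =>
    HasWirtingerAt.of_hasDerivAt ((hasDerivAt_id z).sub_const a)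
  induction m with
  | zero =>
    intro z hz
    have := ((hlin z).mul (hf.hasWirtingerAt hs hz)).dz_eq
    simp only [zero_add, Function.iterate_one, Function.iterate_zero, id_eq, Nat.cast_zero]
    rw [this]; ring
  | succ m ih =>
    intro z hz
    rw [Function.iterate_succ_apply', dz_eqOn hs ih hz]
    have := (((hlin z).mul ((hf.iterate_dz hs (m + 1)).hasWirtingerAt hs hz)).add
      (((hf.iterate_dz hs m).hasWirtingerAt hs hz).const_mul ((m : ℂ) + 1))).dz_eq
    rw [this]
    simp only [Function.iterate_succ_apply']
    push_cast; ring

end Iterate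

/-- **Bol's identity** for a fractional linear change of variable `X` with `X' = c (z - a)⁻²`. -/
theorem bol_identity {s t : Set ℂ} (hs : IsOpen s) (ht : IsOpen t) {X : ℂ → ℂ} {a c : ℂ}
    (ha : a ∉ s) (hX : ∀ z ∈ s, HasDerivAt X (c * ((z - a) ^ 2)⁻¹) z) (hst : Set.MapsTo X s t)
    {g : ℂ → ℂ} (hg : ContDiffOn ℝ ∞ g t) (m : ℕ) :
    Set.EqOn (dz^[m + 1] fun z => (z - a) ^ m * g (X z))
      (fun z => c ^ (m + 1) * ((z - a) ^ (m + 2))⁻¹ * dz^[m + 1] g (X z)) s := by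
  have hne : ∀ z ∈ s, z - a ≠ 0 := fun z hz h => ha (by rwa [← sub_eq_zero.1 h])
  have hXs : ContDiffOn ℝ ∞ X s := by
    have h1 : DifferentiableOn ℂ X s := fun z hz => (hX z
        hz).differentiableAt.differentiableWithinAt
    exact (h1.contDiffOn hs).restrict_scalars ℝ
  induction m with
  | zero =>
    intro z hz
    have h1 : (dz fun z => g (X z)) z = _ :=
      ((hg.hasWirtingerAt ht (hst hz)).comp (hX z hz)).dz_eq
    simp only [zero_add, Function.iterate_one, pow_zero, one_mul, pow_one]
    rw [h1]; ring
  | succ m ih =>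
    intro z hz
    have hu : ContDiffOn ℝ ∞ (fun z => (z - a) ^ m * g (X z)) s :=
      ((contDiffOn_sub_const s a).pow m).mul (hg.comp hXs hst)
    have e1 : (fun z => (z - a) ^ (m + 1) * g (X z))
        = fun z => (z - a) * ((z - a) ^ m * g (X z)) := by
      funext z; ring
    rw [e1, iterate_dz_linear_mul hs hu a (m + 1) hz]
    simp only
    rw [Function.iterate_succ_apply', dz_eqOn hs ih hz, ih hz]
    have hz0 := hne z hz
    have hp : HasDerivAt (fun z : ℂ => ((z - a) ^ (m + 2))⁻¹)
        (-((m + 2) * (z - a) ^ (m + 1)) / ((z - a) ^ (m + 2)) ^ 2) z := by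
      have := (((hasDerivAt_id z).sub_const a).pow (m + 2)).inv (pow_ne_zero _ hz0)
      convert! this using 1
      simp
    have h2 := (((HasWirtingerAt.of_hasDerivAt hp).const_mul (c ^ (m + 1))).mul
      ((((hg.iterate_dz ht (m + 1)).hasWirtingerAt ht (hst hz)).comp (hX z hz)))).dz_eq
    rw [h2, ← Function.iterate_succ_apply' dz (m + 1)]
    push_cast
    field_simp
    ring

/-! ### Laurent series -/

/-- The punctured disc `0 < |w| < ρ` in `ℂ`. -/
def annulus (ρ : ℝ) : Set ℂ := {w | w ≠ 0 ∧ ‖w‖ < ρ}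

theorem isOpen_annulus (ρ : ℝ) : IsOpen (annulus ρ) :=
  isOpen_ne.inter (isOpen_lt continuous_norm continuous_const)

theorem zpow_le_zpow_add_zpow {r₁ r r₂ : ℝ} (h₁ : 0 < r₁) (h : r₁ ≤ r) (h' : r ≤ r₂) (e : ℤ) :
    r ^ e ≤ r₁ ^ e + r₂ ^ e := by
  have hr : 0 < r := h₁.trans_le h
  have hr₂ : 0 < r₂ := hr.trans_le h'
  rcases le_or_gt 0 e with he | he
  · have := zpow_le_zpow_left₀ he hr.le h'
    have := (zpow_pos h₁ e).le
    linarith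
  · obtain ⟨n, rfl⟩ : ∃ n : ℤ, e = -n := ⟨-e, by ring⟩
    have := zpow_le_zpow_left₀ (by lia : 0 ≤ n) h₁.le h
    have h3 := inv_anti₀ (zpow_pos h₁ n) this
    have := (zpow_pos hr₂ (-n)).le
    rw [← zpow_neg, ← zpow_neg] at h3
    linarith

section Laurent
variable {ι : Type*} {a : ι → ℂ} {e : ι → ℤ} {ρ : ℝ}

/-- A family of monomials that converges absolutely on the punctured disc may be differentiated
termwise; no restriction on the exponents `e i` is needed, as on a closed annulus the terms are
dominated by the sum of their values at the two radii. -/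
theorem hasSum_deriv_laurent (hs : ∀ r, 0 < r → r < ρ → Summable fun i => ‖a i‖ * r ^ e i)
    {w : ℂ} (hw : w ∈ annulus ρ) :
    DifferentiableAt ℂ (fun w => ∑' i, a i * w ^ e i) w ∧
    HasSum (fun i => a i * e i * w ^ (e i - 1)) (deriv (fun w => ∑' i, a i * w ^ e i) w) := by
  have hpos : 0 < ‖w‖ := norm_pos_iff.2 hw.1
  have hlt := hw.2
  set r₁ := ‖w‖ / 2
  set r₂ := (‖w‖ + ρ) / 2
  have h1 : 0 < r₁ := by positivity
  have hU : IsOpen {v : ℂ | r₁ < ‖v‖ ∧ ‖v‖ < r₂} :=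
    (isOpen_lt continuous_const continuous_norm).inter (isOpen_lt continuous_norm continuous_const)
  have hwU : w ∈ {v : ℂ | r₁ < ‖v‖ ∧ ‖v‖ < r₂} :=
    ⟨by simp only [r₁]; linarith, by simp only [r₂]; linarith⟩
  have hu := (hs r₁ h1 (by simp only [r₁]; linarith)).add
    (hs r₂ (by simp only [r₂]; linarith) (by simp only [r₂]; linarith))
  have hd : ∀ v : ℂ, v ≠ 0 → ∀ i, HasDerivAt (fun v : ℂ => a i * v ^ e i)
      (a i * (e i * v ^ (e i - 1))) v := fun v hv i =>
    (hasDerivAt_zpow (e i) v (Or.inl hv)).const_mul (a i)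
  have hne : ∀ v ∈ {v : ℂ | r₁ < ‖v‖ ∧ ‖v‖ < r₂}, v ≠ 0 := fun v hv =>
    norm_pos_iff.1 (h1.trans hv.1)
  have hf : ∀ i, DifferentiableOn ℂ (fun v : ℂ => a i * v ^ e i) {v : ℂ | r₁ < ‖v‖ ∧ ‖v‖ < r₂} :=
    fun i v hv => (hd v (hne v hv) i).differentiableAt.differentiableWithinAt
  have hle : ∀ i, ∀ v ∈ {v : ℂ | r₁ < ‖v‖ ∧ ‖v‖ < r₂},
      ‖a i * v ^ e i‖ ≤ ‖a i‖ * r₁ ^ e i + ‖a i‖ * r₂ ^ e i := by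
    intro i v hv
    rw [norm_mul, norm_zpow, ← mul_add]
    exact mul_le_mul_of_nonneg_left (zpow_le_zpow_add_zpow h1 hv.1.le hv.2.le _) (norm_nonneg _)
  refine ⟨(Complex.differentiableOn_tsum_of_summable_norm hu hf hU hle).differentiableAt
    (hU.mem_nhds hwU), ?_⟩
  have := Complex.hasSum_deriv_of_summable_norm hu hf hU hle hwU
  convert! this using 2 with i
  rw [(hd w hw.1 i).deriv, mul_assoc]

theorem summable_deriv_laurent (hs : ∀ r, 0 < r → r < ρ → Summable fun i => ‖a i‖ * r ^ e i) :
    ∀ r, 0 < r → r < ρ → Summable fun i => ‖a i * e i‖ * r ^ (e i - 1) := by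
  intro r h0 hr
  have hn : ‖(r : ℂ)‖ = r := by simp [abs_of_pos h0]
  have h := (hasSum_deriv_laurent hs (w := (r : ℂ))
    ⟨by exact_mod_cast h0.ne', by rwa [hn]⟩).2.summable.norm
  simpa only [norm_mul, norm_zpow, hn] using h

theorem hasDerivAt_laurent (hs : ∀ r, 0 < r → r < ρ → Summable fun i => ‖a i‖ * r ^ e i)
    {w : ℂ} (hw : w ∈ annulus ρ) :
    HasDerivAt (fun w => ∑' i, a i * w ^ e i) (∑' i, a i * e i * w ^ (e i - 1)) w := by
  obtain ⟨h1, h2⟩ := hasSum_deriv_laurent hs hw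
  rw [h2.tsum_eq]; exact h1.hasDerivAt

theorem contDiffOn_laurent (hs : ∀ r, 0 < r → r < ρ → Summable fun i => ‖a i‖ * r ^ e i) :
    ContDiffOn ℝ ∞ (fun w => ∑' i, a i * w ^ e i) (annulus ρ) := by
  have h1 : DifferentiableOn ℂ (fun w => ∑' i, a i * w ^ e i) (annulus ρ) := fun w hw =>
    (hasDerivAt_laurent hs hw).differentiableAt.differentiableWithinAt
  exact (h1.contDiffOn (isOpen_annulus ρ)).restrict_scalars ℝ

/-- Laurent series may be differentiated termwise arbitrarily often. -/
theorem iterate_dz_laurent (hs : ∀ r, 0 < r → r < ρ → Summable fun i => ‖a i‖ * r ^ e i) (m : ℕ) :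
    (∀ r, 0 < r → r < ρ →
      Summable fun i => ‖a i * ∏ l ∈ Finset.range m, ((e i : ℂ) - l)‖ * r ^ (e i - m)) ∧
    Set.EqOn (dz^[m] fun w => ∑' i, a i * w ^ e i)
      (fun w => ∑' i, a i * (∏ l ∈ Finset.range m, ((e i : ℂ) - l)) * w ^ (e i - m))
      (annulus ρ) := by
  induction m with
  | zero => exact ⟨by simpa using hs, fun w _ => by simp⟩
  | succ m ih =>
    have key : ∀ i, a i * (∏ l ∈ Finset.range m, ((e i : ℂ) - l)) * ((e i - m : ℤ) : ℂ)
        = a i * ∏ l ∈ Finset.range (m + 1), ((e i : ℂ) - l) := fun i => by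
      rw [Finset.prod_range_succ]; push_cast; ring
    have key2 : ∀ i, e i - m - 1 = e i - ((m + 1 : ℕ) : ℤ) := fun i => by push_cast; ring
    refine ⟨?_, ?_⟩
    · have := summable_deriv_laurent ih.1
      simpa only [key, key2] using this
    · intro w hw
      rw [Function.iterate_succ_apply', dz_eqOn (isOpen_annulus ρ) ih.2 hw]
      have := (HasWirtingerAt.of_hasDerivAt (hasDerivAt_laurent ih.1 hw)).dz_eq
      simpa only [key, key2] using this

end Laurent

/-- Translation identifies `ℕ` with the integers `n ≥ -N`. -/
def natEquivIci (N : ℕ) : ℕ ≃ Set.Ici (-(N : ℤ)) where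
  toFun l := ⟨(l : ℤ) - N, by simp⟩
  invFun n := ((n : ℤ) + N).toNat
  left_inv l := by simp
  right_inv n := by
    have := n.2
    ext; simp only [Set.mem_Ici] at this ⊢; lia

/-- A holomorphic function with `w ^ N g(w) = o(w⁻¹)` at the puncture has a Laurent expansion
starting at `w ^ (-N)`. -/
theorem exists_hasSum_laurent {g : ℂ → ℂ} {ρ : ℝ} (hρ : 0 < ρ) (hg : DifferentiableOn ℂ g (annulus
    ρ))
    (N : ℕ) (ho : (fun w => w ^ N * g w) =o[𝓝[≠] 0] fun w : ℂ => w⁻¹) :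
    ∃ a : ℤ → ℂ, ∀ w ∈ annulus ρ, HasSum (fun n : Set.Ici (-(N : ℤ)) => a n * w ^ (n : ℤ)) (g w) :=
        by
  -- `w ^ N g(w)` extends holomorphically over `0`; its Taylor series is shifted by `N`.
  set f : ℂ → ℂ := fun w => w ^ N * g w
  have hset : Metric.ball (0 : ℂ) ρ \ {0} = annulus ρ := by
    ext w; simp [annulus, and_comm]
  have hf : DifferentiableOn ℂ f (Metric.ball 0 ρ \ {0}) := by
    rw [hset]; exact (differentiableOn_pow N).mul hg
  have hc : (fun w => f w - f 0) =o[𝓝[≠] 0] fun w : ℂ => (w - 0)⁻¹ := by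
    simp only [sub_zero]
    refine ho.sub ?_
    refine (Asymptotics.isLittleO_const_left).2 (Or.inr ?_)
    exact (tendsto_norm_cobounded_atTop).comp (Filter.tendsto_inv₀_nhdsNE_zero)
  have hd := Complex.differentiableOn_update_limUnder_of_isLittleO
    (Metric.ball_mem_nhds (0 : ℂ) hρ) hf hc
  set h := Function.update f 0 ((𝓝[≠] 0).limUnder f)
  refine ⟨fun n => (((n + N).toNat.factorial : ℕ) : ℂ)⁻¹ * iteratedDeriv (n + N).toNat h 0, ?_⟩
  intro w hw
  have hw' : w ∈ Metric.ball (0 : ℂ) ρ := by simpa using hw.2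
  have hsum := Complex.hasSum_taylorSeries_on_ball hd hw'
  have hval : h w = w ^ N * g w := by simp [h, f, Function.update_of_ne hw.1]
  rw [hval] at hsum
  have h2 := hsum.mul_left ((w ^ N)⁻¹)
  have hN : w ^ N ≠ 0 := pow_ne_zero _ hw.1
  rw [inv_mul_cancel_left₀ hN] at h2
  rw [← (natEquivIci N).hasSum_iff]
  convert! h2 using 2 with l
  simp only [natEquivIci, Function.comp_apply, Equiv.coe_fn_mk, sub_add_cancel, Int.toNat_natCast,
    sub_zero, smul_eq_mul, zpow_sub₀ hw.1, zpow_natCast]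
  ring

/-! ### Incomplete beta functions -/

/-- The coefficient of `u ^ j` in `(1 - u) ^ (a - 1)`. -/
def signedChoose (a j : ℕ) : ℝ := ((a - 1).choose j : ℝ) * (-1) ^ j

theorem sum_signedChoose_mul_pow {a : ℕ} (ha : 1 ≤ a) (u : ℝ) :
    ∑ j ∈ Finset.range a, signedChoose a j * u ^ j = (1 - u) ^ (a - 1) := by
  rw [show (1 - u) = -u + 1 by ring, add_pow, Nat.sub_add_cancel ha]
  refine Finset.sum_congr rfl fun j _ => ?_
  rw [signedChoose, neg_pow u j]; simp; ring

/-- Expanding `(1 - u) ^ (a - 1)` and integrating termwise gives `β₀` in closed form; the logarithm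
comes from the index `j = n`. -/
theorem incBetaZero_eq_sum {a : ℕ} (ha : 1 ≤ a) (n : ℤ) {w : ℝ} (h0 : 0 < w) (h1 : w < 1) :
    incBetaZero (1 - w) a (-n) = ∑ j ∈ Finset.range a, signedChoose a j *
      (if (j : ℤ) = n then -Real.log w else w ^ ((j : ℤ) - n) / ((n : ℝ) - j)) := by
  set G : ℝ → ℝ := fun t => ∑ j ∈ Finset.range a, signedChoose a j *
    (if (j : ℤ) = n then -Real.log (1 - t) else (1 - t) ^ ((j : ℤ) - n) / ((n : ℝ) - j))
  have hIcc : Set.uIcc 0 (1 - w) = Set.Icc 0 (1 - w) := Set.uIcc_of_le (by linarith)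
  have hderiv : ∀ t ∈ Set.uIcc 0 (1 - w),
      HasDerivAt G (t ^ (a - 1) * (1 - t) ^ (-n - 1)) t := by
    intro t ht
    rw [hIcc] at ht
    have hu : 0 < 1 - t := by linarith [ht.2]
    have hs : HasDerivAt (fun t : ℝ => 1 - t) (-1) t := (hasDerivAt_id t).const_sub 1
    have hval : t ^ (a - 1) * (1 - t) ^ (-n - 1)
        = ∑ j ∈ Finset.range a, signedChoose a j * (1 - t) ^ ((j : ℤ) - n - 1) := by
      have := sum_signedChoose_mul_pow ha (1 - t)
      rw [sub_sub_cancel] at this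
      rw [← this, Finset.sum_mul]
      refine Finset.sum_congr rfl fun j _ => ?_
      rw [mul_assoc, ← zpow_natCast, ← zpow_add₀ hu.ne']
      congr 2; ring
    rw [hval]
    refine HasDerivAt.fun_sum fun j _ => HasDerivAt.const_mul _ ?_
    split_ifs with hj
    · convert! (hs.log hu.ne').neg using 1
      rw [hj, sub_self, zero_sub, zpow_neg_one]
      field_simp
    · have hjn : (n : ℝ) - j ≠ 0 := by
        rw [sub_ne_zero]; exact_mod_cast Ne.symm hj
      convert! ((hasDerivAt_zpow ((j : ℤ) - n) (1 - t) (Or.inl hu.ne')).comp t hs).div_const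
        ((n : ℝ) - j) using 1
      push_cast
      field_simp
      ring
  have hint : IntervalIntegrable (fun t : ℝ => t ^ (a - 1) * (1 - t) ^ (-n - 1))
      MeasureTheory.volume 0 (1 - w) := by
    refine ContinuousOn.intervalIntegrable ?_
    rw [hIcc]
    refine (continuousOn_pow _).mul (ContinuousOn.zpow₀ (by fun_prop) _ fun t ht => Or.inl ?_)
    have := ht.2
    exact (by linarith : 0 < 1 - t).ne'
  have hG0 : G 0 = -betaConst a (-n) := by
    simp only [G, betaConst, sub_zero, Real.log_one, neg_zero, one_zpow, neg_neg, Finset.sum_filter]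
    rw [← Finset.sum_neg_distrib]
    refine Finset.sum_congr rfl fun j _ => ?_
    by_cases hj : (j : ℤ) = n
    · simp [hj]
    · have hjn : (n : ℝ) - j ≠ 0 := by
        rw [sub_ne_zero]; exact_mod_cast Ne.symm hj
      have hjn' : (j : ℝ) + ((-n : ℤ) : ℝ) ≠ 0 := by
        push_cast; intro h; apply hjn; linarith
      simp only [hj, if_false, ne_eq, not_false_eq_true, if_true, signedChoose]
      have : (j : ℝ) + ((-n : ℤ) : ℝ) = -((n : ℝ) - j) := by push_cast; ring
      rw [this, div_neg]; ring
  rw [incBetaZero, incBeta, intervalIntegral.integral_eq_sub_of_hasDerivAt hderiv hint, hG0]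
  simp only [G, sub_sub_cancel]
  ring

/-- For `n < 0`, `-β₀` is the integral of `(1 - u) ^ (a - 1) u ^ (-n - 1)` over `[0, w]`, hence not
small compared with `w ^ (-n) / (-n)`. -/
theorem le_neg_incBetaZero {a : ℕ} (ha : 1 ≤ a) (m : ℕ) {w : ℝ} (h0 : 0 < w) (h1 : w < 1) :
    (1 - w) ^ (a - 1) * (w ^ (m + 1) / (m + 1)) ≤ -incBetaZero (1 - w) a (m + 1) := by
  set C := (1 - w) ^ (a - 1)
  set g : ℝ → ℝ := fun u => ∑ j ∈ Finset.range a, signedChoose a j * (u ^ (j + m + 1) / (j + m + 1))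
    - C * (u ^ (m + 1) / (m + 1))
  have hderiv : ∀ u, HasDerivAt g (u ^ m * ((1 - u) ^ (a - 1) - C)) u := by
    intro u
    have hp : ∀ l : ℕ, HasDerivAt (fun u : ℝ => u ^ (l + 1) / (l + 1)) (u ^ l) u := fun l => by
      have := (hasDerivAt_pow (l + 1) u).div_const ((l : ℝ) + 1)
      convert! this using 1
      have : (l : ℝ) + 1 ≠ 0 := by positivity
      push_cast; field_simp
    have hval : u ^ m * ((1 - u) ^ (a - 1) - C)
        = ∑ j ∈ Finset.range a, signedChoose a j * u ^ (j + m) - C * u ^ m := by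
      rw [← sum_signedChoose_mul_pow ha u, mul_sub, Finset.mul_sum, mul_comm C]
      congr 1
      refine Finset.sum_congr rfl fun j _ => by rw [pow_add]; ring
    rw [hval]
    refine (HasDerivAt.fun_sum fun j _ => HasDerivAt.const_mul _ ?_).sub ((hp m).const_mul C)
    have := hp (j + m)
    push_cast at this
    exact this
  have hmono : MonotoneOn g (Set.Icc 0 w) := by
    refine monotoneOn_of_deriv_nonneg (convex_Icc 0 w)
      (fun u _ => (hderiv u).continuousAt.continuousWithinAt)
      (fun u _ => (hderiv u).differentiableAt.differentiableWithinAt) fun u hu => ?_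
    rw [interior_Icc] at hu
    rw [(hderiv u).deriv]
    refine mul_nonneg (pow_nonneg hu.1.le _) (sub_nonneg.2 ?_)
    exact pow_le_pow_left₀ (by linarith) (by linarith [hu.2]) _
  have hle := hmono ⟨le_rfl, h0.le⟩ ⟨h0.le, le_rfl⟩ h0.le
  have hg0 : g 0 = 0 := by simp [g]
  have hβ : -incBetaZero (1 - w) a (m + 1)
      = ∑ j ∈ Finset.range a, signedChoose a j * (w ^ (j + m + 1) / (j + m + 1)) := by
    have := incBetaZero_eq_sum ha (-((m : ℤ) + 1)) h0 h1
    rw [neg_neg] at this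
    rw [this, ← Finset.sum_neg_distrib]
    refine Finset.sum_congr rfl fun j _ => ?_
    rw [if_neg (by lia), show (j : ℤ) - -((m : ℤ) + 1) = ((j + m + 1 : ℕ) : ℤ) by push_cast; ring,
      zpow_natCast]
    have h2 : ((-((m : ℤ) + 1) : ℤ) : ℝ) - j = -((j : ℝ) + m + 1) := by push_cast; ring
    rw [h2, div_neg]; ring
  rw [hβ]
  rw [hg0] at hle
  simp only [g] at hle
  linarith

/-! ### The non-holomorphic part in the disc coordinate -/

/-- The series `∑_{n ≤ N} conj (c n) w ^ (-n - 1)`, to which `ξ` maps the non-holomorphic part. -/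
noncomputable def xiSeries (c : ℤ → ℂ) (N : ℕ) (w : ℂ) : ℂ :=
  ∑' n : Set.Iic (N : ℤ), conj (c n) * w ^ (-(n : ℤ) - 1)

/-- The termwise primitive `∑_{n ≤ N, n ≠ j} conj (c n) w ^ (j - n) / (n - j)` of the series
`-w ^ j * xiSeries c N w` without its `w⁻¹` term. The index `n = j` contributes `0`, as `x / 0 =
0`. -/
noncomputable def primitiveSeries (c : ℤ → ℂ) (N j : ℕ) (w : ℂ) : ℂ :=
  ∑' n : Set.Iic (N : ℤ), conj (c n) / ((n : ℂ) - j) * w ^ ((j : ℤ) - n)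

/-- The coefficient of `w⁻¹` in `w ^ j * conj (xiSeries c N w)`, read as a series in `w̄`. -/
noncomputable def residueCoeff (c : ℤ → ℂ) (N j : ℕ) : ℂ := if j ≤ N then c j else 0

/-- A single-valued function whose `∂/∂z̄`-derivative is `-conj (w ^ j * xiSeries c N w)`; a residue
is accounted for by `log |w|²`. -/
noncomputable def antiPrimitive (c : ℤ → ℂ) (N j : ℕ) (w : ℂ) : ℂ :=
  conj (primitiveSeries c N j w) - residueCoeff c N j * (Real.log (Complex.normSq w) : ℂ)

/-- Absolute convergence of `∑_{n ≤ N} c n * w̄ ^ (-n)` on the punctured disc of radius `ρ`. -/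
def SummableIic (c : ℤ → ℂ) (N : ℕ) (ρ : ℝ) : Prop :=
  ∀ r, 0 < r → r < ρ → Summable fun n : Set.Iic (N : ℤ) => ‖c n‖ * r ^ (-(n : ℤ))

section
variable {c : ℤ → ℂ} {N : ℕ} {ρ : ℝ}

theorem norm_intCast_div_le (x : ℂ) (m : ℤ) : ‖x / (m : ℂ)‖ ≤ ‖x‖ := by
  rcases eq_or_ne m 0 with rfl | hm
  · simp
  · rw [norm_div]
    refine div_le_self (norm_nonneg _) ?_
    rw [Complex.norm_intCast]
    exact_mod_cast Int.one_le_abs hm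

theorem SummableIic.primitive (hs : SummableIic c N ρ) (j : ℕ) : ∀ r, 0 < r → r < ρ →
    Summable fun n : Set.Iic (N : ℤ) => ‖conj (c n) / ((n : ℂ) - j)‖ * r ^ ((j : ℤ) - n) := by
  intro r h0 hr
  refine Summable.of_nonneg_of_le (fun n => by positivity) (fun n => ?_) ((hs r h0 hr).mul_left (r
      ^ j))
  have h1 := norm_intCast_div_le (conj (c n)) ((n : ℤ) - j)
  push_cast at h1
  rw [RCLike.norm_conj] at h1
  rw [sub_eq_add_neg (j : ℤ), zpow_add₀ h0.ne', zpow_natCast]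
  calc _ ≤ ‖c n‖ * (r ^ j * r ^ (-(n : ℤ))) := mul_le_mul_of_nonneg_right h1 (by positivity)
    _ = _ := by ring

theorem SummableIic.summable_xiSeries (hs : SummableIic c N ρ) {w : ℂ} (hw : w ∈ annulus ρ) :
    Summable fun n : Set.Iic (N : ℤ) => conj (c n) * w ^ (-(n : ℤ) - 1) := by
  have h := (hs ‖w‖ (norm_pos_iff.2 hw.1) hw.2).mul_right (‖w‖⁻¹)
  refine Summable.of_norm (h.congr fun n => ?_)
  rw [norm_mul, RCLike.norm_conj, norm_zpow, zpow_sub_one₀ (norm_ne_zero_iff.2 hw.1)]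
  ring

theorem hasSum_ite_natCast {s : Set ℤ} [DecidablePred (· ∈ s)] (j : ℕ) (x : ℂ) :
    HasSum (fun n : s => if (j : ℤ) = n then x else 0) (if (j : ℤ) ∈ s then x else 0) := by
  split_ifs with h
  · convert! hasSum_ite_eq (⟨j, h⟩ : s) x using 2 with n
    simp [Subtype.ext_iff, eq_comm]
  · convert! hasSum_zero (α := ℂ) (β := s) using 2 with n
    rw [if_neg]
    rintro e
    exact h (e ▸ n.2)

theorem hasDerivAt_primitiveSeries (hs : SummableIic c N ρ) (j : ℕ) {w : ℂ} (hw : w ∈ annulus ρ) :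
    HasDerivAt (primitiveSeries c N j) (-(w ^ j * xiSeries c N w) + conj (residueCoeff c N j) *
        w⁻¹) w := by
  have h := hasDerivAt_laurent (hs.primitive j) hw
  convert! h using 1
  have h1 := (hs.summable_xiSeries hw).hasSum.mul_left (-(w ^ j))
  have h2 := hasSum_ite_natCast (s := Set.Iic (N : ℤ)) j (conj (c j) * w⁻¹)
  have h3 := h1.add h2
  have hw0 := hw.1
  have hval : -(w ^ j * xiSeries c N w) + conj (residueCoeff c N j) * w⁻¹
      = -w ^ j * xiSeries c N w + if (j : ℤ) ∈ Set.Iic (N : ℤ) then conj (c j) * w⁻¹ else 0 := by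
    simp only [residueCoeff, Set.mem_Iic, Nat.cast_le]
    split_ifs <;> simp
  rw [hval, xiSeries, ← h3.tsum_eq]
  refine tsum_congr fun n => ?_
  by_cases hj : (j : ℤ) = n
  · have hj' : ((n : ℤ) : ℂ) - j = 0 := by rw [← hj]; simp
    rw [if_pos hj, hj', ← hj, zpow_sub_one₀ hw0, zpow_neg, zpow_natCast]
    simp only [div_zero, zero_mul]
    field_simp; ring
  · have hj' : ((n : ℤ) : ℂ) - j ≠ 0 := by
      rw [sub_ne_zero]; exact_mod_cast Ne.symm hj
    have hp : w ^ ((j : ℤ) - n - 1) = w ^ j * w ^ (-(n : ℤ) - 1) := by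
      rw [← zpow_natCast, ← zpow_add₀ hw0]; congr 1; ring
    rw [if_neg hj, hp]
    push_cast
    field_simp; ring

theorem contDiffOn_antiPrimitive (hs : SummableIic c N ρ) (j : ℕ) :
    ContDiffOn ℝ ∞ (antiPrimitive c N j) (annulus ρ) := by
  have h1 : ContDiffOn ℝ ∞ (primitiveSeries c N j) (annulus ρ) := contDiffOn_laurent (hs.primitive
      j)
  have h2 : ContDiffOn ℝ ∞ (fun w : ℂ => ((Real.log (Complex.normSq w) : ℝ) : ℂ)) (annulus ρ) := by
    refine Complex.ofRealCLM.contDiff.comp_contDiffOn (ContDiffOn.log ?_ fun w hw => ?_)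
    · have : ⇑Complex.normSq = fun w => w.re * w.re + w.im * w.im := by
        funext w; rw [Complex.normSq_apply]
      rw [this]
      have hre : ContDiff ℝ ∞ (fun w : ℂ => w.re) := Complex.reCLM.contDiff
      have him : ContDiff ℝ ∞ (fun w : ℂ => w.im) := Complex.imCLM.contDiff
      exact ((hre.mul hre).add (him.mul him)).contDiffOn
    · simpa using hw.1
  exact (Complex.conjCLE.contDiff.comp_contDiffOn h1).sub (contDiffOn_const.mul h2)

theorem hasWirtingerAt_antiPrimitive (hs : SummableIic c N ρ) (j : ℕ) {w : ℂ} (hw : w ∈ annulus ρ) :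
    HasWirtingerAt (antiPrimitive c N j) (-(residueCoeff c N j * w⁻¹))
      (-conj (w ^ j * xiSeries c N w)) w := by
  have hw0 := hw.1
  have hcw : conj w ≠ 0 := by simpa using hw0
  have hn : Complex.normSq w ≠ 0 := by simpa using hw0
  have h1 := (HasWirtingerAt.of_hasDerivAt (hasDerivAt_primitiveSeries hs j hw)).conjugate
  have h2 := ((hasWirtingerAt_normSq w).real_comp (Real.hasDerivAt_log hn)).const_mul
    (residueCoeff c N j)
  have hnorm : ((Complex.normSq w : ℝ) : ℂ) = w * conj w := (Complex.mul_conj w).symm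
  refine (h1.sub h2).congr_val ?_ ?_
  · rw [map_zero, Complex.ofReal_inv, hnorm]; field_simp; ring
  · rw [Complex.ofReal_inv, hnorm, map_add, map_neg, map_mul (starRingEnd ℂ) (conj _), map_inv₀,
      Complex.conj_conj]
    field_simp; ring

/-- The non-holomorphic part of an elliptic expansion, in the disc coordinate. -/
noncomputable def nonholPart (a : ℕ) (c : ℤ → ℂ) (N : ℕ) (w : ℂ) : ℂ :=
  ∑ j ∈ Finset.range a, (signedChoose a j : ℂ) * (w ^ j * antiPrimitive c N j w)

theorem contDiffOn_nonholPart (hs : SummableIic c N ρ) (a : ℕ) :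
    ContDiffOn ℝ ∞ (nonholPart a c N) (annulus ρ) :=
  ContDiffOn.sum fun j _ => contDiffOn_const.mul
    ((contDiffOn_id.pow j).mul (contDiffOn_antiPrimitive hs j))

/-- The binomial theorem reassembles the factor `(1 - |w|²) ^ (a - 1)`. -/
theorem hasWirtingerAt_nonholPart (hs : SummableIic c N ρ) {a : ℕ} (ha : 1 ≤ a) {w : ℂ}
    (hw : w ∈ annulus ρ) : HasWirtingerAt (nonholPart a c N) (dz (nonholPart a c N) w)
      (-(((1 - Complex.normSq w) ^ (a - 1) : ℝ) : ℂ) * conj (xiSeries c N w)) w := by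
  have h : HasWirtingerAt (nonholPart a c N) _ _ w := HasWirtingerAt.sum fun j _ =>
    ((HasWirtingerAt.of_hasDerivAt (hasDerivAt_pow j w)).mul
      (hasWirtingerAt_antiPrimitive hs j hw)).const_mul (signedChoose a j : ℂ)
  refine h.congr_val h.dz_eq.symm ?_
  rw [← sum_signedChoose_mul_pow ha, Complex.ofReal_sum, ← Finset.sum_neg_distrib, Finset.sum_mul]
  refine Finset.sum_congr rfl fun j _ => ?_
  rw [Complex.ofReal_mul, Complex.ofReal_pow, ← Complex.mul_conj, map_mul, map_pow]
  ring

/-- The factorials produced by differentiating `w ^ j log |w|²` cancel the binomial coefficient. -/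
theorem signedChoose_mul_factorial {a j : ℕ} (hj : j < a) :
    signedChoose a j * (j.factorial * ((-1) ^ (a - 1 - j) * (a - 1 - j).factorial))
      = (-1) ^ (a - 1) * (a - 1).factorial := by
  have h := Nat.choose_mul_factorial_mul_factorial (show j ≤ a - 1 by omega)
  have h2 : (-1 : ℝ) ^ (a - 1) = (-1) ^ j * (-1) ^ (a - 1 - j) := by
    rw [← pow_add]; congr 1; omega
  rw [signedChoose, h2, ← h]; push_cast; ring

theorem iterate_dz_zpow (n : ℤ) (m : ℕ) :
    Set.EqOn (dz^[m] fun w => w ^ n)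
      (fun w => (∏ l ∈ Finset.range m, ((n : ℂ) - l)) * w ^ (n - m)) {w | w ≠ 0} := by
  induction m with
  | zero => intro w _; simp
  | succ m ih =>
    intro w hw
    rw [Function.iterate_succ_apply', dz_eqOn isOpen_ne ih hw]
    have h := ((HasWirtingerAt.of_hasDerivAt (hasDerivAt_zpow (n - m) w (Or.inl hw))).const_mul
      (∏ l ∈ Finset.range m, ((n : ℂ) - l))).dz_eq
    rw [h, Finset.prod_range_succ]
    push_cast
    rw [sub_sub]; ring

theorem contDiffOn_zpow_annulus (n : ℤ) : ContDiffOn ℝ ∞ (fun w : ℂ => w ^ n) (annulus ρ) := by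
  have h1 : DifferentiableOn ℂ (fun w : ℂ => w ^ n) (annulus ρ) := fun w hw =>
    (hasDerivAt_zpow n w (Or.inl hw.1)).differentiableAt.differentiableWithinAt
  exact (h1.contDiffOn (isOpen_annulus ρ)).restrict_scalars ℝ

theorem iterate_dz_pow_eq_zero {j m : ℕ} (h : j < m) :
    Set.EqOn (dz^[m] fun w => w ^ j) (fun _ => 0) (annulus ρ) := by
  intro w hw
  have := iterate_dz_zpow (j : ℤ) m hw.1
  simp only [zpow_natCast] at this
  rw [this, Finset.prod_eq_zero (Finset.mem_range.2 h) (by simp), zero_mul]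

/-- Like a logarithm, `w ^ j L` is mapped to a multiple of `w⁻¹` by `j + 1` derivatives if
`∂L/∂z = γ w⁻¹`. -/
theorem iterate_dz_pow_mul_of_dz_eq_inv {L : ℂ → ℂ} {γ : ℂ} (hL : ContDiffOn ℝ ∞ L (annulus ρ))
    (hd : ∀ w ∈ annulus ρ, dz L w = γ * w⁻¹) (j : ℕ) :
    Set.EqOn (dz^[j + 1] fun w => w ^ j * L w) (fun w => γ * j.factorial * w⁻¹) (annulus ρ) := by
  have ho := isOpen_annulus ρ
  induction j with
  | zero => intro w hw; simpa using hd w hw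
  | succ j ih =>
    intro w hw
    have h1 : Set.EqOn (dz fun w => w ^ (j + 1) * L w)
        (fun w => ((j : ℂ) + 1) * (w ^ j * L w) + γ * w ^ j) (annulus ρ) := by
      intro w hw
      rw [((HasWirtingerAt.of_hasDerivAt (hasDerivAt_pow (j + 1) w)).mul
        (hL.hasWirtingerAt ho hw)).dz_eq, hd w hw]
      have := hw.1
      push_cast; rw [pow_succ]; field_simp
    have hsm : ContDiffOn ℝ ∞ (fun w : ℂ => w ^ j) (annulus ρ) := contDiffOn_id.pow j
    rw [Function.iterate_succ_apply, iterate_dz_eqOn ho h1 (j + 1) hw,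
      iterate_dz_add ho (contDiffOn_const.mul (hsm.mul hL)) (contDiffOn_const.mul hsm) (j + 1) hw]
    simp only
    rw [iterate_dz_const_mul ho (hsm.mul hL) _ (j + 1) hw, iterate_dz_const_mul ho hsm _ (j + 1) hw]
    simp only
    rw [ih hw, iterate_dz_pow_eq_zero (Nat.lt_succ_self j) hw, Nat.factorial_succ]
    push_cast; ring

theorem prod_neg_one_sub (m : ℕ) :
    ∏ l ∈ Finset.range m, (((-1 : ℤ) : ℂ) - l) = (-1) ^ m * m.factorial := by
  induction m with
  | zero => simp
  | succ m ih => rw [Finset.prod_range_succ, ih, Nat.factorial_succ]; push_cast; ring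

/-- Only the logarithms of the non-holomorphic part survive `a` derivatives. -/
theorem iterate_dz_nonholPart (hs : SummableIic c N ρ) (a : ℕ) :
    Set.EqOn (dz^[a] (nonholPart a c N))
      (fun w => -((-1) ^ (a - 1) * (a - 1).factorial) *
        ∑ j ∈ Finset.range a, residueCoeff c N j * w ^ ((j : ℤ) - a)) (annulus ρ) := by
  intro w hw
  have ho := isOpen_annulus ρ
  have hsm : ∀ j, ContDiffOn ℝ ∞ (fun w => w ^ j * antiPrimitive c N j w) (annulus ρ) := fun j =>
    (contDiffOn_id.pow j).mul (contDiffOn_antiPrimitive hs j)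
  have h0 := iterate_dz_sum ho (Finset.range a)
    (f := fun j w => (signedChoose a j : ℂ) * (w ^ j * antiPrimitive c N j w))
    (fun j _ => contDiffOn_const.mul (hsm j)) a hw
  have h1 : dz^[a] (nonholPart a c N) w = _ := h0
  rw [h1]
  simp only
  rw [Finset.mul_sum]
  refine Finset.sum_congr rfl fun j hj => ?_
  rw [Finset.mem_range] at hj
  rw [iterate_dz_const_mul ho (hsm j) _ a hw]
  simp only
  obtain ⟨m, rfl⟩ : ∃ m, a = m + (j + 1) := ⟨a - (j + 1), by omega⟩
  rw [Function.iterate_add_apply]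
  have hinv : ContDiffOn ℝ ∞ (fun w : ℂ => w⁻¹) (annulus ρ) := by
    simpa using contDiffOn_zpow_annulus (ρ := ρ) (-1)
  rw [iterate_dz_eqOn ho (iterate_dz_pow_mul_of_dz_eq_inv (γ := -residueCoeff c N j)
    (contDiffOn_antiPrimitive hs j) (fun w hw => by
      rw [(hasWirtingerAt_antiPrimitive hs j hw).dz_eq, neg_mul]) j) m hw,
    iterate_dz_const_mul ho hinv _ m hw]
  have h3 := iterate_dz_zpow (-1) m hw.1
  simp only [zpow_neg_one] at h3
  simp only
  rw [h3, prod_neg_one_sub]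
  have h4 := signedChoose_mul_factorial (a := m + (j + 1)) (j := j) (by omega)
  rw [show m + (j + 1) - 1 - j = m by omega] at h4
  have h5 : (signedChoose (m + (j + 1)) j : ℂ) * ((j.factorial : ℂ) * ((-1) ^ m * (m.factorial :
      ℂ)))
      = (-1) ^ (m + (j + 1) - 1) * ((m + (j + 1) - 1).factorial : ℂ) := by exact_mod_cast h4
  rw [← h5, show (-1 : ℤ) - m = (j : ℤ) - ((m + (j + 1) : ℕ) : ℤ) by push_cast; ring]
  ring

/-- The terms of the non-holomorphic series are those of the elliptic expansion with `β₀`. -/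
theorem hasSum_nonholPart (hs : SummableIic c N ρ) (hρ : ρ ≤ 1) {a : ℕ} (ha : 1 ≤ a) {w : ℂ}
    (hw : w ∈ annulus ρ) : HasSum (fun n : Set.Iic (N : ℤ) =>
      c n * (incBetaZero (1 - ‖w‖ ^ 2) a (-(n : ℤ)) : ℂ) * w ^ (n : ℤ)) (nonholPart a c N w) := by
  have hpos : 0 < ‖w‖ := norm_pos_iff.2 hw.1
  have hw0 := hw.1
  have hcw : conj w ≠ 0 := by simpa using hw0
  have hlt : ‖w‖ ^ 2 < 1 := by
    have := hw.2.trans_le hρ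
    nlinarith
  have hterm : ∀ j ∈ Finset.range a, HasSum (fun n : Set.Iic (N : ℤ) =>
      (signedChoose a j : ℂ) * (w ^ j * (conj (conj (c n) / ((n : ℂ) - j) * w ^ ((j : ℤ) - n))
        - if (j : ℤ) = n then c j * (Real.log (Complex.normSq w) : ℂ) else 0)))
      ((signedChoose a j : ℂ) * (w ^ j * antiPrimitive c N j w)) := by
    intro j _
    refine HasSum.mul_left _ (HasSum.mul_left _ (HasSum.sub ?_ ?_))
    · have h1 : Summable fun n : Set.Iic (N : ℤ) => conj (c n) / ((n : ℂ) - j) * w ^ ((j : ℤ) - n)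
        := by
        refine Summable.of_norm ?_
        simpa only [norm_mul, norm_zpow] using hs.primitive j ‖w‖ hpos hw.2
      exact h1.hasSum.map (starRingEnd ℂ) Complex.continuous_conj
    · convert! hasSum_ite_natCast (s := Set.Iic (N : ℤ)) j _ using 1
      simp [residueCoeff]
  have h := hasSum_sum hterm
  convert! h using 2 with n
  have hβ := incBetaZero_eq_sum ha n (w := ‖w‖ ^ 2) (by positivity) hlt
  rw [hβ, Complex.ofReal_sum, Finset.mul_sum, Finset.sum_mul]
  refine Finset.sum_congr rfl fun j _ => ?_
  have hnorm : ((‖w‖ ^ 2 : ℝ) : ℂ) = w * conj w := by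
    rw [Complex.mul_conj, Complex.normSq_eq_norm_sq]
  rw [Complex.normSq_eq_norm_sq]
  by_cases hj : (j : ℤ) = n
  · have hj' : ((n : ℤ) : ℂ) - j = 0 := by rw [← hj]; simp
    rw [if_pos hj, if_pos hj, hj', ← hj, zpow_natCast]
    simp only [div_zero, zero_mul, map_zero]
    push_cast; ring
  · rw [if_neg hj, if_neg hj, sub_zero, Complex.ofReal_mul, Complex.ofReal_div, Complex.ofReal_zpow,
      hnorm, mul_zpow, map_mul, map_div₀, map_zpow₀, Complex.conj_conj, map_sub,
          Complex.conj_natCast,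
      map_intCast]
    push_cast
    have : w ^ j = w ^ ((j : ℤ) - n) * w ^ (n : ℤ) := by
      rw [← zpow_add₀ hw0, sub_add_cancel, zpow_natCast]
    rw [this]; ring

end

/-! ### A Cauchy estimate for `∂/∂z̄` -/

/-- Stokes' theorem for `∂/∂z̄` on a disc, in polar coordinates. -/
theorem integral_dzBar_disc {f a b : ℂ → ℂ} {x : ℂ} {δ : ℝ} (hδ : 0 < δ)
    (hf : ∀ v ∈ Metric.closedBall x δ, HasWirtingerAt f (a v) (b v) v)
    (hb : ContinuousOn b (Metric.closedBall x δ)) :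
    ∫ s in (0 : ℝ)..δ, ∫ θ in (0 : ℝ)..2 * Real.pi, 2 * (s : ℂ) * b (circleMap x s θ) =
      ∫ θ in (0 : ℝ)..2 * Real.pi, (δ : ℂ) * Complex.exp (θ * Complex.I) * f (circleMap x δ θ) := by
  -- In polar coordinates `q = (s, θ)` with `p q = x + s e^{iθ}`, the field
  -- `(s e^{iθ} f, i e^{iθ} f)` has divergence `2 s ∂f/∂z̄`; the second component is periodic in `θ`
  -- and the first vanishes at `s = 0`.
  set E : ℝ × ℝ → ℂ := fun q => Complex.exp (q.2 * Complex.I)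
  set p : ℝ × ℝ → ℂ := fun q => circleMap x q.1 q.2
  set dS : ℝ × ℝ →L[ℝ] ℂ := Complex.ofRealCLM.comp (ContinuousLinearMap.fst ℝ ℝ ℝ)
  set dT : ℝ × ℝ →L[ℝ] ℂ := Complex.ofRealCLM.comp (ContinuousLinearMap.snd ℝ ℝ ℝ)
  have hS : ∀ q, HasFDerivAt (fun q : ℝ × ℝ => (q.1 : ℂ)) dS q := fun q => dS.hasFDerivAt
  have hT : ∀ q, HasFDerivAt (fun q : ℝ × ℝ => (q.2 : ℂ)) dT q := fun q => dT.hasFDerivAt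
  have hE : ∀ q, HasFDerivAt E ((E q * Complex.I) • dT) q := fun q => by
    refine ((hT q).mul_const Complex.I).cexp.congr_fderiv ?_
    ext <;> simp [E] <;> ring
  set p' : ℝ × ℝ → (ℝ × ℝ →L[ℝ] ℂ) := fun q => E q • dS + (q.1 * E q * Complex.I) • dT
  have hp : ∀ q, HasFDerivAt p (p' q) q := fun q => by
    refine (((hS q).mul (hE q)).const_add x).congr_fderiv ?_
    ext <;> simp [p'] <;> ring
  have hEcont : Continuous E := by fun_prop
  have hpcont : Continuous p := continuous_iff_continuousAt.2 fun q => (hp q).continuousAt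
  have hrect : Set.uIcc 0 δ ×ˢ Set.uIcc 0 (2 * Real.pi) =
      (Set.Icc 0 δ ×ˢ Set.Icc 0 (2 * Real.pi) : Set (ℝ × ℝ)) := by
    rw [Set.uIcc_of_le hδ.le, Set.uIcc_of_le Real.two_pi_pos.le]
  have hmem : ∀ q ∈ Set.uIcc 0 δ ×ˢ Set.uIcc 0 (2 * Real.pi), p q ∈ Metric.closedBall x δ := by
    intro q hq
    rw [hrect] at hq
    simp only [p, Metric.mem_closedBall, dist_eq_norm, circleMap_sub_center, norm_circleMap_zero]
    rw [abs_of_nonneg hq.1.1]; exact hq.1.2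
  set F : ℝ × ℝ → ℂ := fun q => (q.1 : ℂ) * E q * f (p q)
  set G : ℝ × ℝ → ℂ := fun q => Complex.I * E q * f (p q)
  set W : ℝ × ℝ → (ℝ × ℝ →L[ℝ] ℂ) := fun q => (wirtingerMap (a (p q)) (b (p q))).comp (p' q)
  set F' : ℝ × ℝ → (ℝ × ℝ →L[ℝ] ℂ) := fun q => (E q * f (p q)) • dS
    + (q.1 * Complex.I * E q * f (p q)) • dT + (q.1 * E q) • W q
  set G' : ℝ × ℝ → (ℝ × ℝ →L[ℝ] ℂ) := fun q => (Complex.I * Complex.I * E q * f (p q)) • dT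
    + (Complex.I * E q) • W q
  have hfp : ∀ q ∈ Set.uIcc 0 δ ×ˢ Set.uIcc 0 (2 * Real.pi),
      HasFDerivAt (fun q => f (p q)) (W q) q := fun q hq => HasFDerivAt.comp q (hf _ (hmem q hq))
          (hp q)
  have hF : ∀ q ∈ Set.uIcc 0 δ ×ˢ Set.uIcc 0 (2 * Real.pi), HasFDerivAt F (F' q) q := by
    intro q hq
    refine (((hS q).mul (hE q)).mul (hfp q hq)).congr_fderiv ?_
    ext <;> simp [F', W] <;> ring
  have hG : ∀ q ∈ Set.uIcc 0 δ ×ˢ Set.uIcc 0 (2 * Real.pi), HasFDerivAt G (G' q) q := by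
    intro q hq
    refine (((hE q).const_mul Complex.I).mul (hfp q hq)).congr_fderiv ?_
    ext <;> simp [G', W] <;> ring_nf <;> simp only [Complex.I_sq] <;> ring
  have hdiv : ∀ q, F' q (1, 0) + G' q (0, 1) = 2 * (q.1 : ℂ) * b (p q) := by
    intro q
    have hEE : E q * conj (E q) = 1 := by
      rw [Complex.mul_conj, Complex.normSq_eq_norm_sq, Complex.norm_exp_ofReal_mul_I]; simp
    simp only [F', G', W, p', dS, dT, add_apply, smul_apply, ContinuousLinearMap.comp_apply,
      ContinuousLinearMap.coe_fst', ContinuousLinearMap.coe_snd', Complex.ofRealCLM_apply,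
      Complex.ofReal_one, Complex.ofReal_zero, smul_eq_mul, mul_one, mul_zero, add_zero, zero_add,
      wirtingerMap_apply, map_mul, Complex.conj_I, Complex.conj_ofReal]
    linear_combination (2 * q.1 * b (p q)) * hEE + (E q * f (p q) + q.1 * a (p q) * E q ^ 2
      - q.1 * b (p q) * E q * conj (E q)) * Complex.I_sq
  have hsub : ∀ q ∈ Set.Ioo (min 0 δ) (max 0 δ) ×ˢ Set.Ioo (min 0 (2 * Real.pi))
      (max 0 (2 * Real.pi)) \ (∅ : Set (ℝ × ℝ)), q ∈ Set.uIcc 0 δ ×ˢ Set.uIcc 0 (2 * Real.pi) :=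
    fun q hq => ⟨Set.Ioo_subset_Icc_self hq.1.1, Set.Ioo_subset_Icc_self hq.1.2⟩
  have hcont : ContinuousOn (fun q => 2 * (q.1 : ℂ) * b (p q))
      (Set.uIcc 0 δ ×ˢ Set.uIcc 0 (2 * Real.pi)) :=
    (Continuous.continuousOn (by fun_prop)).mul (hb.comp hpcont.continuousOn hmem)
  have hint : MeasureTheory.IntegrableOn (fun q => F' q (1, 0) + G' q (0, 1))
      (Set.uIcc 0 δ ×ˢ Set.uIcc 0 (2 * Real.pi)) := by
    simp only [hdiv]
    exact hcont.integrableOn_compact (isCompact_uIcc.prod isCompact_uIcc)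
  have key := MeasureTheory.integral2_divergence_prod_of_hasFDerivAt_off_countable F G F' G' 0 0 δ
    (2 * Real.pi) ∅ Set.countable_empty
    (fun q hq => (hF q hq).continuousAt.continuousWithinAt)
    (fun q hq => (hG q hq).continuousAt.continuousWithinAt)
    (fun q hq => hF q (hsub q hq)) (fun q hq => hG q (hsub q hq)) hint
  simp only [hdiv] at key
  refine key.trans ?_
  have hper : ∀ s : ℝ, G (s, 2 * Real.pi) = G (s, 0) := by
    intro s
    simp [G, E, p, circleMap, Complex.exp_two_pi_mul_I]
  simp [hper, F, E, p]

/-- A Cauchy estimate: a bound for `f` gives a bound for the antiholomorphic part of `∂f/∂z̄`. -/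
theorem norm_le_of_dzBar_eq_conj_add {f a Ψ e : ℂ → ℂ} {x : ℂ} {δ M M' : ℝ} (hδ : 0 < δ)
    (hf : ∀ v ∈ Metric.closedBall x δ, HasWirtingerAt f (a v) (conj (Ψ v) + e v) v)
    (hΨ : ∀ v ∈ Metric.closedBall x δ, DifferentiableAt ℂ Ψ v)
    (he : ContinuousOn e (Metric.closedBall x δ))
    (hM : ∀ v ∈ Metric.closedBall x δ, ‖f v‖ ≤ M) (hM' : ∀ v ∈ Metric.closedBall x δ, ‖e v‖ ≤ M') :
    ‖Ψ x‖ ≤ M / δ + 2 * M' := by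
  have hmem : ∀ s ∈ Set.Icc 0 δ, ∀ θ, circleMap x s θ ∈ Metric.closedBall x δ := by
    intro s hs θ
    simp only [Metric.mem_closedBall, dist_eq_norm, circleMap_sub_center, norm_circleMap_zero]
    rw [abs_of_nonneg hs.1]; exact hs.2
  have hΨc : ContinuousOn Ψ (Metric.closedBall x δ) := fun v hv =>
    (hΨ v hv).continuousAt.continuousWithinAt
  have hcΨ : ContinuousOn (fun v => conj (Ψ v)) (Metric.closedBall x δ) :=
    Complex.continuous_conj.comp_continuousOn hΨc
  -- Subtracting `v ↦ conj (Ψ x * v)` removes the value at the centre, the mean of `conj Ψ`.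
  have hf2 : ∀ v ∈ Metric.closedBall x δ, HasWirtingerAt (fun v => f v - conj (Ψ x * (v - x)))
      (a v) (conj (Ψ v) + e v - conj (Ψ x)) v := fun v hv => by
    have h1 := (HasWirtingerAt.of_hasDerivAt
      (((hasDerivAt_id v).sub_const x).const_mul (Ψ x))).conjugate
    refine ((hf v hv).sub h1).congr_val ?_ ?_ <;> simp
  have key := integral_dzBar_disc hδ hf2 ((hcΨ.add he).sub continuousOn_const)
  have hcirc : ∀ s ∈ Set.Icc 0 δ, ∀ g : ℂ → ℂ, ContinuousOn g (Metric.closedBall x δ) →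
      Continuous fun θ : ℝ => g (circleMap x s θ) := fun s hs g hg =>
    continuousOn_univ.1 (hg.comp (continuous_circleMap x s).continuousOn fun θ _ => hmem s hs θ)
  have hinner : ∀ s ∈ Set.Icc 0 δ, ‖∫ θ in (0 : ℝ)..2 * Real.pi, 2 * (s : ℂ) *
      (conj (Ψ (circleMap x s θ)) + e (circleMap x s θ) - conj (Ψ x))‖
        ≤ 2 * δ * M' * (2 * Real.pi) := by
    intro s hs
    have hmean : ∫ θ in (0 : ℝ)..2 * Real.pi, conj (Ψ (circleMap x s θ)) - conj (Ψ x) = 0 := by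
      have hd : DiffContOnCl ℂ Ψ (Metric.ball x |s|) := by
        rw [abs_of_nonneg hs.1]
        refine DifferentiableOn.diffContOnCl fun v hv => ?_
        refine (hΨ v ?_).differentiableWithinAt
        exact Metric.closedBall_subset_closedBall hs.2 (Metric.closure_ball_subset_closedBall hv)
      have h1 := hd.circleAverage
      rw [Real.circleAverage_def, inv_smul_eq_iff₀ (by positivity)] at h1
      have h2 : ∫ θ in (0 : ℝ)..2 * Real.pi, conj (Ψ (circleMap x s θ))
          = conj (∫ θ in (0 : ℝ)..2 * Real.pi, Ψ (circleMap x s θ)) :=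
        intervalIntegral.intervalIntegral_conj
      rw [intervalIntegral.integral_sub ((hcirc s hs _ hcΨ).intervalIntegrable _ _)
        intervalIntegrable_const, h2, h1]
      simp [Complex.conj_ofNat]
    have hsplit : ∫ θ in (0 : ℝ)..2 * Real.pi, 2 * (s : ℂ) *
        (conj (Ψ (circleMap x s θ)) + e (circleMap x s θ) - conj (Ψ x))
        = 2 * s * ∫ θ in (0 : ℝ)..2 * Real.pi, e (circleMap x s θ) := by
      rw [intervalIntegral.integral_const_mul]
      congr 1
      have h3 : ∀ θ : ℝ, conj (Ψ (circleMap x s θ)) + e (circleMap x s θ) - conj (Ψ x)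
          = (conj (Ψ (circleMap x s θ)) - conj (Ψ x)) + e (circleMap x s θ) := fun θ => by ring
      simp only [h3]
      have h7 : Continuous fun θ : ℝ => conj (Ψ (circleMap x s θ)) - conj (Ψ x) :=
        (hcirc s hs _ hcΨ).sub continuous_const
      rw [intervalIntegral.integral_add (h7.intervalIntegrable _ _) ((hcirc s hs _
          he).intervalIntegrable _ _), hmean, zero_add]
    rw [hsplit, norm_mul]
    have h4 := intervalIntegral.norm_integral_le_of_norm_le_const (a := 0) (b := 2 * Real.pi)
      (f := fun θ => e (circleMap x s θ)) (C := M') fun θ _ => hM' _ (hmem s hs θ)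
    rw [sub_zero, abs_of_pos Real.two_pi_pos] at h4
    have h5 : ‖2 * (s : ℂ)‖ ≤ 2 * δ := by
      rw [norm_mul, Complex.norm_real, Real.norm_of_nonneg hs.1]; simpa using hs.2
    calc _ ≤ 2 * δ * (M' * (2 * Real.pi)) := mul_le_mul h5 h4 (norm_nonneg _) (by positivity)
      _ = _ := by ring
  have hL := intervalIntegral.norm_integral_le_of_norm_le_const (a := 0) (b := δ)
    (f := fun s : ℝ => ∫ θ in (0 : ℝ)..2 * Real.pi, 2 * (s : ℂ) *
      (conj (Ψ (circleMap x s θ)) + e (circleMap x s θ) - conj (Ψ x))) fun s hs => hinner s (by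
        rw [Set.uIoc_of_le hδ.le] at hs; exact ⟨hs.1.le, hs.2⟩)
  rw [key, sub_zero, abs_of_pos hδ] at hL
  have hδmem : δ ∈ Set.Icc 0 δ := ⟨hδ.le, le_rfl⟩
  have hfc : ContinuousOn f (Metric.closedBall x δ) := fun v hv =>
    (HasFDerivAt.continuousAt (hf v hv)).continuousWithinAt
  have hR : ∫ θ in (0 : ℝ)..2 * Real.pi, (δ : ℂ) * Complex.exp (θ * Complex.I) *
      (f (circleMap x δ θ) - conj (Ψ x * (circleMap x δ θ - x)))
      = (∫ θ in (0 : ℝ)..2 * Real.pi, (δ : ℂ) * Complex.exp (θ * Complex.I) * f (circleMap x δ θ))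
        - 2 * Real.pi * δ ^ 2 * conj (Ψ x) := by
    have h6 : ∀ θ : ℝ, (δ : ℂ) * Complex.exp (θ * Complex.I) *
        (f (circleMap x δ θ) - conj (Ψ x * (circleMap x δ θ - x)))
        = (δ : ℂ) * Complex.exp (θ * Complex.I) * f (circleMap x δ θ) - δ ^ 2 * conj (Ψ x) := by
      intro θ
      have hEE : Complex.exp (θ * Complex.I) * conj (Complex.exp (θ * Complex.I)) = 1 := by
        rw [Complex.mul_conj, Complex.normSq_eq_norm_sq, Complex.norm_exp_ofReal_mul_I]; simp
      rw [circleMap_sub_center, circleMap_zero, map_mul, map_mul, Complex.conj_ofReal]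
      linear_combination (-δ ^ 2 * conj (Ψ x)) * hEE
    simp only [h6]
    have h8 : Continuous fun θ : ℝ =>
        (δ : ℂ) * Complex.exp (θ * Complex.I) * f (circleMap x δ θ) :=
      Continuous.mul (by fun_prop) (hcirc δ hδmem f hfc)
    rw [intervalIntegral.integral_sub (h8.intervalIntegrable _ _) intervalIntegrable_const,
      intervalIntegral.integral_const]
    simp; ring
  rw [hR] at hL
  have hB := intervalIntegral.norm_integral_le_of_norm_le_const (a := 0) (b := 2 * Real.pi)
    (f := fun θ : ℝ => (δ : ℂ) * Complex.exp (θ * Complex.I) * f (circleMap x δ θ)) (C := δ * M)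
    fun θ _ => by
      rw [norm_mul, norm_mul, Complex.norm_exp_ofReal_mul_I, mul_one, Complex.norm_real,
        Real.norm_of_nonneg hδ.le]
      exact mul_le_mul_of_nonneg_left (hM _ (hmem δ hδmem θ)) hδ.le
  rw [sub_zero, abs_of_pos Real.two_pi_pos] at hB
  have hT := (norm_sub_norm_le _ _).trans ((norm_sub_rev _ _).trans_le hL)
  have hnorm : ‖2 * (Real.pi : ℂ) * (δ : ℂ) ^ 2 * conj (Ψ x)‖ = 2 * Real.pi * δ ^ 2 * ‖Ψ x‖ := by
    simp [abs_of_pos Real.pi_pos, abs_of_pos hδ]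
  rw [hnorm] at hT
  have hfin : (2 * Real.pi * δ ^ 2) * ‖Ψ x‖ ≤ (2 * Real.pi * δ ^ 2) * (M / δ + 2 * M') := by
    have : (2 * Real.pi * δ ^ 2) * (M / δ + 2 * M')
        = δ * M * (2 * Real.pi) + 2 * δ * M' * (2 * Real.pi) * δ := by field_simp
    linarith
  exact le_of_mul_le_mul_left hfin (by positivity)

/-! ### Existence of the expansion in the disc coordinate -/

theorem annulus_mem_nhdsWithin {ε : ℝ} (hε : 0 < ε) : annulus ε ∈ 𝓝[≠] (0 : ℂ) := by
  filter_upwards [self_mem_nhdsWithin, mem_nhdsWithin_of_mem_nhds (Metric.ball_mem_nhds (0 : ℂ) hε)]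
    with w h1 h2
  exact ⟨h1, by simpa using h2⟩

theorem isLittleO_inv_of_bound {f : ℂ → ℂ} {ε K : ℝ} (hε : 0 < ε) (h : ∀ w ∈ annulus ε, ‖f w‖ ≤ K) :
    f =o[𝓝[≠] 0] fun w : ℂ => w⁻¹ := by
  have h1 : f =O[𝓝[≠] 0] fun _ => (1 : ℝ) := Asymptotics.IsBigO.of_bound K (by
    filter_upwards [annulus_mem_nhdsWithin hε] with w hw
    simpa using h w hw)
  refine h1.trans_isLittleO ((Asymptotics.isLittleO_const_left).2 (Or.inr ?_))
  exact tendsto_norm_cobounded_atTop.comp Filter.tendsto_inv₀_nhdsNE_zero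

theorem isLittleO_log_inv :
    (fun w : ℂ => (Real.log (Complex.normSq w) : ℂ)) =o[𝓝[≠] 0] fun w : ℂ => w⁻¹ := by
  refine Asymptotics.isLittleO_of_tendsto' ?_ ?_
  · filter_upwards [self_mem_nhdsWithin] with w hw h
    exact absurd (inv_eq_zero.1 h) hw
  · rw [tendsto_zero_iff_norm_tendsto_zero]
    have h1 : Continuous fun w : ℂ => ‖2 * (‖w‖ * Real.log ‖w‖)‖ :=
      ((Real.continuous_mul_log.comp continuous_norm).const_mul 2).norm
    have h2 := (h1.tendsto 0).mono_left (nhdsWithin_le_nhds (s := {0}ᶜ))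
    simp only [norm_zero, zero_mul, mul_zero] at h2
    refine h2.congr fun w => ?_
    rw [div_inv_eq_mul, norm_mul (_ : ℂ) w, Complex.norm_real, Complex.normSq_eq_norm_sq,
      Real.log_pow, norm_mul, norm_mul, norm_mul, norm_norm]
    push_cast; ring

/-- The logarithm prevents `O(1)` here, but `o(w⁻¹)` suffices for removing the singularity. -/
theorem isLittleO_antiPrimitive {c : ℤ → ℂ} {N : ℕ} {ρ : ℝ} (hρ : 0 < ρ) (hs : SummableIic c N ρ)
    (j : ℕ) : (fun w => w ^ N * antiPrimitive c N j w) =o[𝓝[≠] 0] fun w : ℂ => w⁻¹ := by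
  have hr0 : 0 < ρ / 2 := by linarith
  have hS := (hs.primitive j (ρ / 2) hr0 (by linarith)).mul_left ((ρ / 2) ^ N)
  have h1 : (fun w => w ^ N * conj (primitiveSeries c N j w)) =o[𝓝[≠] 0] fun w : ℂ => w⁻¹ := by
    refine isLittleO_inv_of_bound hr0 fun w hw => le_trans ?_ (le_refl
      (∑' n : Set.Iic (N : ℤ), (ρ / 2) ^ N * (‖conj (c n) / ((n : ℂ) - j)‖ * (ρ / 2) ^ ((j : ℤ) -
          n))))
    have hpos : 0 < ‖w‖ := norm_pos_iff.2 hw.1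
    have hSw := hs.primitive j ‖w‖ hpos (hw.2.trans (by linarith))
    rw [norm_mul, RCLike.norm_conj, norm_pow]
    have h2 : ‖primitiveSeries c N j w‖
        ≤ ∑' n : Set.Iic (N : ℤ), ‖conj (c n) / ((n : ℂ) - j)‖ * ‖w‖ ^ ((j : ℤ) - n) := by
      refine (norm_tsum_le_tsum_norm ?_).trans_eq ?_
      · simpa only [norm_mul, norm_zpow] using hSw
      · simp only [norm_mul, norm_zpow]
    refine (mul_le_mul_of_nonneg_left h2 (by positivity)).trans ?_
    rw [← tsum_mul_left]
    refine (hSw.mul_left _).tsum_le_tsum (fun n => ?_) hS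
    have hn : (0 : ℤ) ≤ N + ((j : ℤ) - n) := by
      have := n.2; simp only [Set.mem_Iic] at this; lia
    have h3 := zpow_le_zpow_left₀ hn hpos.le hw.2.le
    rw [zpow_add₀ hpos.ne', zpow_add₀ hr0.ne', zpow_natCast, zpow_natCast] at h3
    calc _ = ‖conj (c n) / ((n : ℂ) - j)‖ * (‖w‖ ^ N * ‖w‖ ^ ((j : ℤ) - n)) := by ring
      _ ≤ _ := mul_le_mul_of_nonneg_left h3 (norm_nonneg _)
      _ = _ := by ring
  have h2 : (fun w : ℂ => w ^ N * (residueCoeff c N j * (Real.log (Complex.normSq w) : ℂ)))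
      =o[𝓝[≠] 0] fun w : ℂ => w⁻¹ := by
    have hb : (fun w : ℂ => w ^ N) =O[𝓝[≠] 0] fun _ => (1 : ℂ) :=
      (((continuous_pow N).tendsto (0 : ℂ)).mono_left nhdsWithin_le_nhds).isBigO_one ℂ
    simpa using hb.mul_isLittleO (isLittleO_log_inv.const_mul_left (residueCoeff c N j))
  refine (h1.sub h2).congr_left fun w => ?_
  rw [antiPrimitive]; ring

theorem isLittleO_nonholPart {c : ℤ → ℂ} {N : ℕ} {ρ : ℝ} (hρ : 0 < ρ) (hs : SummableIic c N ρ)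
    (a : ℕ) : (fun w => w ^ N * nonholPart a c N w) =o[𝓝[≠] 0] fun w : ℂ => w⁻¹ := by
  have h : ∀ j ∈ Finset.range a, (fun w => (signedChoose a j : ℂ) *
      (w ^ j * (w ^ N * antiPrimitive c N j w))) =o[𝓝[≠] 0] fun w : ℂ => w⁻¹ := by
    intro j _
    have hb : (fun w : ℂ => w ^ j) =O[𝓝[≠] 0] fun _ => (1 : ℂ) :=
      (((continuous_pow j).tendsto (0 : ℂ)).mono_left nhdsWithin_le_nhds).isBigO_one ℂ
    simpa using (hb.mul_isLittleO (isLittleO_antiPrimitive hρ hs j)).const_mul_left (signedChoose a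
        j : ℂ)
  refine (Asymptotics.IsLittleO.sum h).congr_left fun w => ?_
  rw [nonholPart, Finset.mul_sum, Finset.sum_apply]
  exact Finset.sum_congr rfl fun j _ => by ring

/-- The growth of `H` bounds the order of the pole of `Ψ`. -/
theorem exists_bound_pole {a N : ℕ} {ρ ε M : ℝ} (hρ : 0 < ρ) (hε : 0 < ε) {H Ψ : ℂ → ℂ}
    (hH : ∀ w ∈ annulus ρ, HasWirtingerAt H (dz H w)
      (-(((1 - Complex.normSq w) ^ (a - 1) : ℝ) : ℂ) * conj (Ψ w)) w)
    (hΨ : DifferentiableOn ℂ Ψ (annulus ρ)) (hM : ∀ w ∈ annulus ε, ‖w‖ ^ N * ‖H w‖ ≤ M) :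
    ∃ ε' > 0, ∃ K, ∀ w ∈ annulus ε', ‖w ^ (N + 1) * Ψ w‖ ≤ K := by
  set ε₀ := min (min ε ρ) 1
  have hε₀ : 0 < ε₀ := lt_min (lt_min hε hρ) one_pos
  have hε₁ : ε₀ ≤ ε := (min_le_left _ _).trans (min_le_left _ _)
  have hε₂ : ε₀ ≤ ρ := (min_le_left _ _).trans (min_le_right _ _)
  have hε₃ : ε₀ ≤ 1 := min_le_right _ _
  set m : ℤ := -((a - 1 : ℕ) : ℤ)
  set K₁ : ℝ := (7 / 16 : ℝ) ^ m + 1 ^ m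
  set K₂ : ℝ := (7 / 16 : ℝ) ^ (m - 1) + 1 ^ (m - 1)
  refine ⟨ε₀ / 2, by linarith, K₁ * M * 2 ^ (N + 1) + 2 * (|(m : ℝ)| * K₂ * M * 2 ^ N), ?_⟩
  intro x hx
  have hx0 : 0 < ‖x‖ := norm_pos_iff.2 hx.1
  have hx1 : ‖x‖ < ε₀ / 2 := hx.2
  have hlo : ∀ v ∈ Metric.closedBall x (‖x‖ / 2), ‖x‖ / 2 ≤ ‖v‖ := fun v hv => by
    have h1 := norm_sub_norm_le x v
    rw [Metric.mem_closedBall, dist_comm, dist_eq_norm] at hv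
    linarith
  have hhi : ∀ v ∈ Metric.closedBall x (‖x‖ / 2), ‖v‖ < 3 / 4 * ε₀ := fun v hv => by
    have h1 := norm_sub_norm_le v x
    rw [Metric.mem_closedBall, dist_eq_norm] at hv
    linarith
  have hv0 : ∀ v ∈ Metric.closedBall x (‖x‖ / 2), v ≠ 0 := fun v hv =>
    norm_pos_iff.1 (lt_of_lt_of_le (by linarith) (hlo v hv))
  have hann : ∀ v ∈ Metric.closedBall x (‖x‖ / 2), v ∈ annulus ρ := fun v hv =>
    ⟨hv0 v hv, by have := hhi v hv; linarith⟩
  have hp : ∀ v ∈ Metric.closedBall x (‖x‖ / 2), 7 / 16 ≤ 1 - Complex.normSq v := fun v hv => by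
    have h1 := hhi v hv
    have h2 : ‖v‖ ≤ 3 / 4 := by linarith
    rw [Complex.normSq_eq_norm_sq]
    nlinarith [norm_nonneg v]
  have hp1 : ∀ v : ℂ, 1 - Complex.normSq v ≤ 1 := fun v => by linarith [Complex.normSq_nonneg v]
  have hHv : ∀ v ∈ Metric.closedBall x (‖x‖ / 2), ‖H v‖ ≤ M * 2 ^ N / ‖x‖ ^ N := fun v hv => by
    have h1 := hM v ⟨hv0 v hv, by have := hhi v hv; linarith⟩
    have h2 : (‖x‖ / 2) ^ N ≤ ‖v‖ ^ N := pow_le_pow_left₀ (by positivity) (hlo v hv) N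
    rw [le_div_iff₀ (by positivity)]
    have h3 : (‖x‖ / 2) ^ N * ‖H v‖ ≤ M :=
      (mul_le_mul_of_nonneg_right h2 (norm_nonneg _)).trans h1
    rw [div_pow, div_mul_eq_mul_div, div_le_iff₀ (by positivity)] at h3
    linarith
  have hB0 : 0 ≤ M * 2 ^ N / ‖x‖ ^ N :=
    (norm_nonneg _).trans (hHv x (Metric.mem_closedBall_self (by positivity)))
  have hz : ∀ (n : ℤ), ∀ v ∈ Metric.closedBall x (‖x‖ / 2),
      ‖(((1 - Complex.normSq v) ^ n : ℝ) : ℂ)‖ ≤ (7 / 16 : ℝ) ^ n + 1 ^ n := fun n v hv => by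
    have h1 := hp v hv
    rw [Complex.norm_real, Real.norm_of_nonneg (zpow_nonneg (by linarith) _)]
    exact zpow_le_zpow_add_zpow (by norm_num) h1 (hp1 v) n
  have hW : ∀ v ∈ Metric.closedBall x (‖x‖ / 2),
      HasWirtingerAt (fun v => (((1 - Complex.normSq v) ^ m : ℝ) : ℂ))
        (((m * (1 - Complex.normSq v) ^ (m - 1) : ℝ) : ℂ) * -conj v)
        (((m * (1 - Complex.normSq v) ^ (m - 1) : ℝ) : ℂ) * -v) v := fun v hv => by
    have h0 : HasWirtingerAt (fun v => ((1 - Complex.normSq v : ℝ) : ℂ)) (-conj v) (-v) v := by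
      have := (HasWirtingerAt.of_hasDerivAt (hasDerivAt_const v (1 : ℂ))).sub
          (hasWirtingerAt_normSq v)
      simpa using this
    have h1 := hp v hv
    exact h0.real_comp (hasDerivAt_zpow m _ (Or.inl (by linarith)))
  -- Dividing `H` by `(1 - |v|²) ^ (a - 1)` frees `conj Ψ` from its factor, at the cost of
  -- an error `e`.
  set e : ℂ → ℂ := fun v => (((m * (1 - Complex.normSq v) ^ (m - 1) : ℝ) : ℂ) * v) * H v
  have hf : ∀ v ∈ Metric.closedBall x (‖x‖ / 2), HasWirtingerAt
      (fun v => (-1) * ((((1 - Complex.normSq v) ^ m : ℝ) : ℂ) * H v))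
      (dz (fun v => (-1) * ((((1 - Complex.normSq v) ^ m : ℝ) : ℂ) * H v)) v)
      (conj (Ψ v) + e v) v := fun v hv => by
    have h2 := ((hW v hv).mul (hH v (hann v hv))).const_mul (-1)
    refine h2.congr_val h2.dz_eq.symm ?_
    have h1 := hp v hv
    have h3 : (((1 - Complex.normSq v) ^ m : ℝ) : ℂ) * (((1 - Complex.normSq v) ^ (a - 1) : ℝ) : ℂ)
        = 1 := by
      rw [← Complex.ofReal_mul, ← zpow_natCast, ← zpow_add₀ (by linarith)]
      simp [m]
    simp only [e]
    linear_combination conj (Ψ v) * h3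
  have hHc : ContinuousOn H (Metric.closedBall x (‖x‖ / 2)) := fun v hv =>
    (HasFDerivAt.continuousAt (hH v (hann v hv))).continuousWithinAt
  have hnc : Continuous fun v : ℂ => 1 - Complex.normSq v :=
    continuous_const.sub Complex.continuous_normSq
  have he : ContinuousOn e (Metric.closedBall x (‖x‖ / 2)) := by
    refine ContinuousOn.mul (ContinuousOn.mul ?_ continuousOn_id) hHc
    refine Complex.continuous_ofReal.comp_continuousOn (continuousOn_const.mul ?_)
    exact hnc.continuousOn.zpow₀ _ fun v hv => Or.inl (by have := hp v hv; linarith)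
  have hmain := norm_le_of_dzBar_eq_conj_add (M := K₁ * (M * 2 ^ N / ‖x‖ ^ N))
    (M' := |(m : ℝ)| * K₂ * (M * 2 ^ N / ‖x‖ ^ N)) (by positivity) hf
    (fun v hv => hΨ.differentiableAt ((isOpen_annulus ρ).mem_nhds (hann v hv))) he
    (fun v hv => by
      rw [norm_mul, norm_neg, norm_one, one_mul, norm_mul]
      exact mul_le_mul (hz m v hv) (hHv v hv) (norm_nonneg _) (by positivity))
    (fun v hv => by
      simp only [e]
      rw [norm_mul, norm_mul, Complex.ofReal_mul, norm_mul, Complex.norm_real, Real.norm_eq_abs]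
      refine mul_le_mul ?_ (hHv v hv) (norm_nonneg _) (by positivity)
      have h1 : ‖v‖ ≤ 1 := by have := hhi v hv; linarith
      calc _ ≤ |(m : ℝ)| * K₂ * 1 := mul_le_mul (mul_le_mul_of_nonneg_left (hz (m - 1) v hv)
            (abs_nonneg _)) h1 (norm_nonneg _) (by positivity)
        _ = _ := mul_one _)
  rw [norm_mul, norm_pow]
  have hxN : ‖x‖ ^ N ≠ 0 := by positivity
  calc ‖x‖ ^ (N + 1) * ‖Ψ x‖ ≤ ‖x‖ ^ (N + 1) * _ := mul_le_mul_of_nonneg_left hmain (by positivity)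
    _ = K₁ * M * 2 ^ (N + 1) + 2 * (|(m : ℝ)| * K₂ * M * 2 ^ N) * ‖x‖ := by
      rw [pow_succ, pow_succ]; field_simp
    _ ≤ _ := by
      have hM0 : 0 ≤ M := by
        have := hM x ⟨hx.1, by linarith⟩
        exact le_trans (by positivity) this
      have : 2 * (|(m : ℝ)| * K₂ * M * 2 ^ N) * ‖x‖ ≤ 2 * (|(m : ℝ)| * K₂ * M * 2 ^ N) * 1 :=
        mul_le_mul_of_nonneg_left (by linarith) (by positivity)
      linarith

/-- The reflection `n ↦ -n - 1` identifies the integers `n ≤ N` with the integers `≥ -(N + 1)`. -/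
def reflectEquiv (N : ℕ) : Set.Iic (N : ℤ) ≃ Set.Ici (-((N + 1 : ℕ) : ℤ)) where
  toFun n := ⟨-(n : ℤ) - 1, by have := n.2; simp only [Set.mem_Iic, Set.mem_Ici] at *; lia⟩
  invFun n := ⟨-(n : ℤ) - 1, by have := n.2; simp only [Set.mem_Iic, Set.mem_Ici] at *; lia⟩
  left_inv n := by ext; simp
  right_inv n := by ext; simp

/-- A solution of `∂H/∂w̄ = -(1 - |w|²) ^ (a - 1) conj Ψ` with `H = O(|w| ^ (-N))` is a Laurent
series
plus a non-holomorphic part. -/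
theorem exists_disc_expansion {a N : ℕ} (ha : 1 ≤ a) {ρ ε M : ℝ} (hρ : 0 < ρ) (hε : 0 < ε)
    {H Ψ : ℂ → ℂ}
    (hH : ∀ w ∈ annulus ρ, HasWirtingerAt H (dz H w)
      (-(((1 - Complex.normSq w) ^ (a - 1) : ℝ) : ℂ) * conj (Ψ w)) w)
    (hΨ : DifferentiableOn ℂ Ψ (annulus ρ)) (hM : ∀ w ∈ annulus ε, ‖w‖ ^ N * ‖H w‖ ≤ M) :
    ∃ cPlus cMinus : ℤ → ℂ, SummableIic cMinus N ρ ∧ ∀ w ∈ annulus ρ,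
      HasSum (fun n : Set.Ici (-(N : ℤ)) => cPlus n * w ^ (n : ℤ)) (H w - nonholPart a cMinus N w)
          := by
  obtain ⟨ε', hε', K, hK⟩ := exists_bound_pole hρ hε hH hΨ hM
  obtain ⟨ψ, hψ⟩ := exists_hasSum_laurent hρ hΨ (N + 1) (isLittleO_inv_of_bound hε' hK)
  set c : ℤ → ℂ := fun n => conj (ψ (-n - 1))
  have hsum : ∀ w ∈ annulus ρ,
      HasSum (fun n : Set.Iic (N : ℤ) => conj (c n) * w ^ (-(n : ℤ) - 1)) (Ψ w) := fun w hw => by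
    have := (reflectEquiv N).hasSum_iff.2 (hψ w hw)
    simpa [c, reflectEquiv, Function.comp_def] using this
  have hs : SummableIic c N ρ := by
    intro r h0 hr
    have hn : ‖(r : ℂ)‖ = r := by simp [abs_of_pos h0]
    have h := (hsum (r : ℂ) ⟨by exact_mod_cast h0.ne', by rwa [hn]⟩).summable.norm.mul_right r
    refine h.congr fun n => ?_
    rw [norm_mul, norm_zpow, hn, RCLike.norm_conj, zpow_sub_one₀ h0.ne']
    field_simp
  have hxi : ∀ w ∈ annulus ρ, xiSeries c N w = Ψ w := fun w hw => (hsum w hw).tsum_eq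
  have hg : DifferentiableOn ℂ (fun w => H w - nonholPart a c N w) (annulus ρ) := by
    intro w hw
    have h := (hH w hw).sub (hasWirtingerAt_nonholPart hs ha hw)
    rw [hxi w hw, sub_self] at h
    exact h.hasDerivAt.differentiableAt.differentiableWithinAt
  have ho : (fun w => w ^ N * (H w - nonholPart a c N w)) =o[𝓝[≠] 0] fun w : ℂ => w⁻¹ := by
    have h1 : (fun w => w ^ N * H w) =o[𝓝[≠] 0] fun w : ℂ => w⁻¹ :=
      isLittleO_inv_of_bound hε (K := M) fun w hw => by
        rw [norm_mul, norm_pow]; exact hM w hw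
    exact (h1.sub (isLittleO_nonholPart hρ hs a)).congr_left fun w => by ring
  obtain ⟨cP, hcP⟩ := exists_hasSum_laurent hρ hg N ho
  exact ⟨cP, c, hs, hcP⟩

/-! ### The disc coordinate on the upper half-plane -/

/-- The disc coordinate `X_ϱ` as a function on `ℂ`. -/
noncomputable def discCoord (ϱ : ℍ) (z : ℂ) : ℂ := (z - ϱ) / (z - conj (ϱ : ℂ))

/-- The inverse of the disc coordinate. -/
noncomputable def discInv (ϱ : ℍ) (w : ℂ) : ℂ := ((ϱ : ℂ) - w * conj (ϱ : ℂ)) / (1 - w)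

section
variable (ϱ : ℍ)

theorem conj_eq_sub_im : conj (ϱ : ℂ) = ϱ - 2 * Complex.I * ϱ.im := by
  apply Complex.ext
  · simp
  · simp; ring

theorem sub_conj_ne_zero {z : ℂ} (hz : 0 < z.im) : z - conj (ϱ : ℂ) ≠ 0 := by
  intro h
  have h1 := congrArg Complex.im h
  have h2 := ϱ.im_pos
  simp at h1
  linarith

theorem hasDerivAt_discCoord {z : ℂ} (hz : 0 < z.im) : HasDerivAt (discCoord ϱ)
    (2 * Complex.I * ϱ.im * ((z - conj (ϱ : ℂ)) ^ 2)⁻¹) z := by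
  have hne := sub_conj_ne_zero ϱ hz
  have h := ((hasDerivAt_id z).sub_const (ϱ : ℂ)).div ((hasDerivAt_id z).sub_const (conj (ϱ : ℂ)))
      hne
  convert! h using 1
  have := conj_eq_sub_im ϱ
  simp only [id]
  field_simp
  linear_combination this

theorem one_sub_normSq_discCoord {z : ℂ} (hz : 0 < z.im) :
    1 - Complex.normSq (discCoord ϱ z) = 4 * ϱ.im * z.im / Complex.normSq (z - conj (ϱ : ℂ)) := by
  have hne : Complex.normSq (z - conj (ϱ : ℂ)) ≠ 0 := by simpa using sub_conj_ne_zero ϱ hz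
  rw [discCoord, Complex.normSq_div, eq_div_iff hne, sub_mul, div_mul_cancel₀ _ hne,
    Complex.normSq_apply, Complex.normSq_apply]
  simp
  ring

theorem norm_discCoord_lt_one {z : ℂ} (hz : 0 < z.im) : ‖discCoord ϱ z‖ < 1 := by
  have h := one_sub_normSq_discCoord ϱ hz
  have h1 : 0 < Complex.normSq (z - conj (ϱ : ℂ)) := Complex.normSq_pos.2 (sub_conj_ne_zero ϱ hz)
  have h2 : 0 < 4 * ϱ.im * z.im / Complex.normSq (z - conj (ϱ : ℂ)) := by
    have := ϱ.im_pos
    positivity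
  rw [← h, Complex.normSq_eq_norm_sq] at h2
  nlinarith [norm_nonneg (discCoord ϱ z)]

theorem discCoord_ne_zero {z : ℂ} (hz : 0 < z.im) (h : z ≠ ϱ) : discCoord ϱ z ≠ 0 :=
  div_ne_zero (sub_ne_zero.2 h) (sub_conj_ne_zero ϱ hz)

variable {w : ℂ}

theorem one_sub_ne_zero_of_norm_lt (hw : ‖w‖ < 1) : 1 - w ≠ 0 := by
  intro h
  rw [← sub_eq_zero.1 h] at hw
  simp at hw

theorem discInv_sub_conj (hw : ‖w‖ < 1) :
    discInv ϱ w - conj (ϱ : ℂ) = 2 * Complex.I * ϱ.im / (1 - w) := by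
  have := one_sub_ne_zero_of_norm_lt hw
  have h := conj_eq_sub_im ϱ
  rw [discInv, eq_div_iff this, sub_mul, div_mul_cancel₀ _ this]
  linear_combination -h

theorem discCoord_discInv (hw : ‖w‖ < 1) : discCoord ϱ (discInv ϱ w) = w := by
  have h1 := one_sub_ne_zero_of_norm_lt hw
  have h := conj_eq_sub_im ϱ
  have hη : (ϱ.im : ℂ) ≠ 0 := by exact_mod_cast ϱ.im_pos.ne'
  have h2 : discInv ϱ w - ϱ = 2 * Complex.I * ϱ.im * w / (1 - w) := by
    rw [discInv, eq_div_iff h1, sub_mul, div_mul_cancel₀ _ h1]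
    linear_combination -w * h
  rw [discCoord, h2, discInv_sub_conj ϱ hw]
  have := Complex.I_ne_zero
  field_simp

theorem discInv_im_pos (hw : ‖w‖ < 1) : 0 < (discInv ϱ w).im := by
  have h1 := one_sub_ne_zero_of_norm_lt hw
  have h2 : 0 < Complex.normSq (1 - w) := Complex.normSq_pos.2 h1
  have h3 : Complex.normSq w < 1 := by
    rw [Complex.normSq_eq_norm_sq]; nlinarith [norm_nonneg w]
  have h4 : (discInv ϱ w).im = ϱ.im * (1 - Complex.normSq w) / Complex.normSq (1 - w) := by
    rw [discInv, Complex.div_im, ← sub_div]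
    congr 1
    simp [Complex.normSq_apply]; ring
  rw [h4]
  have := ϱ.im_pos
  have : 0 < 1 - Complex.normSq w := by linarith
  positivity

theorem hasDerivAt_discInv (hw : ‖w‖ < 1) :
    HasDerivAt (discInv ϱ) (2 * Complex.I * ϱ.im / (1 - w) ^ 2) w := by
  have h1 := one_sub_ne_zero_of_norm_lt hw
  have h := (((hasDerivAt_id w).mul_const (conj (ϱ : ℂ))).const_sub (ϱ : ℂ)).div
    ((hasDerivAt_id w).const_sub 1) h1
  convert! h using 1
  have := conj_eq_sub_im ϱ
  simp only [id]
  field_simp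
  linear_combination this

end

/-- The image of `puncturedDisc` in `ℂ`. -/
def coePuncturedDisc (ϱ : ℍ) (R : ℝ) : Set ℂ :=
  {z | 0 < z.im} ∩ discCoord ϱ ⁻¹' annulus (min R 1)

theorem isOpen_coePuncturedDisc (ϱ : ℍ) (R : ℝ) : IsOpen (coePuncturedDisc ϱ R) := by
  refine ContinuousOn.isOpen_inter_preimage (fun z hz => ?_)
    (isOpen_lt continuous_const Complex.continuous_im) (isOpen_annulus _)
  exact (hasDerivAt_discCoord ϱ hz).continuousAt.continuousWithinAt

theorem coe_mem_coePuncturedDisc {ϱ z : ℍ} {R : ℝ} :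
    (z : ℂ) ∈ coePuncturedDisc ϱ R ↔ z ∈ puncturedDisc ϱ R := by
  constructor
  · rintro ⟨_, h1, h2⟩
    refine ⟨?_, h2.trans_le (min_le_left _ _)⟩
    rintro rfl
    exact h1 (by simp [discCoord])
  · rintro ⟨h1, h2⟩
    refine ⟨z.im_pos, discCoord_ne_zero ϱ z.im_pos fun h => h1 (UpperHalfPlane.ext h), ?_⟩
    exact lt_min h2 (norm_discCoord_lt_one ϱ z.im_pos)

theorem discInv_mem_coePuncturedDisc {ϱ : ℍ} {R : ℝ} {w : ℂ} (hw : w ∈ annulus (min R 1)) :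
    discInv ϱ w ∈ coePuncturedDisc ϱ R := by
  have h1 : ‖w‖ < 1 := hw.2.trans_le (min_le_right _ _)
  refine ⟨discInv_im_pos ϱ h1, ?_⟩
  rwa [Set.mem_preimage, discCoord_discInv ϱ h1]

theorem comp_ofComplex_eventuallyEq {g : ℍ → ℂ} {G : ℂ → ℂ} {z : ℂ} (hz : 0 < z.im)
    (h : ∀ z : ℍ, g z = G z) : g ∘ UpperHalfPlane.ofComplex =ᶠ[𝓝 z] G := by
  filter_upwards [(isOpen_lt continuous_const Complex.continuous_im).mem_nhds hz] with v hv
  rw [Function.comp_apply, h, UpperHalfPlane.ofComplex_apply_of_im_pos hv]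

/-! ### Differential operators -/

theorem iterD_eq_iterate_dz (m : ℕ) (f : ℍ → ℂ) (z : ℍ) :
    iterD m f z = (1 / (2 * (Real.pi : ℂ) * Complex.I)) ^ m
      * dz^[m] (f ∘ UpperHalfPlane.ofComplex) z := by
  induction m generalizing z with
  | zero => simp [iterD]
  | succ m ih =>
    have h1 : iterD (m + 1) f z
        = 1 / (2 * (Real.pi : ℂ) * Complex.I) * dz (iterD m f ∘ UpperHalfPlane.ofComplex) z := by
      rw [iterD, Function.iterate_succ_apply']; rfl
    have h3 := comp_ofComplex_eventuallyEq (G := (1 / (2 * (Real.pi : ℂ) * Complex.I)) ^ m •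
      dz^[m] (f ∘ UpperHalfPlane.ofComplex)) z.im_pos ih
    rw [h1, dz_congr_of_eventuallyEq h3, Function.iterate_succ_apply', dz, dz,
      fderiv_const_smul_field]
    simp only [Pi.smul_apply, smul_apply, smul_eq_mul]
    ring

/-- `Δ_{2κ} F = 0` says that `y ^ (2κ) ∂F/∂z̄` is antiholomorphic. -/
theorem differentiableAt_conj_dzBar {k : ℕ} {F : ℍ → ℂ} {U : Set ℍ}
    (hF : IsHarmonicOn (1 - (k : ℤ)) F U) {z : ℍ} (hz : z ∈ U) :
    DifferentiableAt ℂ (fun v : ℂ => conj ((((v.im : ℝ) ^ (2 * (1 - (k : ℤ))) : ℝ) : ℂ) *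
      dzBar (F ∘ UpperHalfPlane.ofComplex) v)) z := by
  obtain ⟨hC, hL⟩ := hF z hz
  set f := F ∘ UpperHalfPlane.ofComplex
  have hsymm : IsSymmSndFDerivAt ℝ f z := hC.isSymmSndFDerivAt (by simp)
  have hd1 : DifferentiableAt ℝ (fderiv ℝ f) z :=
    (hC.fderiv_right (m := 1) (by norm_num)).differentiableAt (by simp)
  set D := fderiv ℝ (fderiv ℝ f) z
  have hev : ∀ u : ℂ, HasFDerivAt (fun v => fderiv ℝ f v u)
      ((ContinuousLinearMap.apply ℝ ℂ u).comp D) z := fun u =>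
    (ContinuousLinearMap.apply ℝ ℂ u).hasFDerivAt.comp (z : ℂ) hd1.hasFDerivAt
  have hX : partialX (partialX F) z = D 1 1 := by
    have h1 : partialX F ∘ UpperHalfPlane.ofComplex =ᶠ[𝓝 (z : ℂ)] fun v => fderiv ℝ f v 1 :=
      comp_ofComplex_eventuallyEq z.im_pos fun _ => rfl
    rw [partialX, h1.fderiv_eq, (hev 1).fderiv]; rfl
  have hY : partialY (partialY F) z = D Complex.I Complex.I := by
    have h1 : partialY F ∘ UpperHalfPlane.ofComplex =ᶠ[𝓝 (z : ℂ)]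
        fun v => fderiv ℝ f v Complex.I :=
      comp_ofComplex_eventuallyEq z.im_pos fun _ => rfl
    rw [partialY, h1.fderiv_eq, (hev Complex.I).fderiv]; rfl
  have hG : HasWirtingerAt (dzBar f) ((D 1 1 + D Complex.I Complex.I) / 4)
      (dzBar (dzBar f) z) z := by
    have h1 : HasFDerivAt (dzBar f) _ (z : ℂ) :=
      ((hev 1).add ((hev Complex.I).const_mul Complex.I)).mul_const (2 : ℂ)⁻¹
    have h2 := hasWirtingerAt_of_hasFDerivAt h1
    refine h2.congr_val ?_ h2.dzBar_eq.symm
    -- The mixed second derivatives cancel by symmetry.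
    have hs := hsymm.eq 1 Complex.I
    simp [ContinuousLinearMap.apply_apply]
    change D 1 Complex.I = D Complex.I 1 at hs
    rw [hs]
    linear_combination (-(D Complex.I Complex.I) / 4) * Complex.I_sq
  have hy : (z.im : ℝ) ≠ 0 := z.im_pos.ne'
  have hp := (hasWirtingerAt_im (z : ℂ)).real_comp
    (hasDerivAt_zpow (2 * (1 - (k : ℤ))) (z : ℂ).im (Or.inl hy))
  have hmul := (hp.mul hG).conjugate
  refine (HasWirtingerAt.hasDerivAt (hmul.congr_val rfl ?_)).differentiableAt
  have hdef : partialX F z + Complex.I * partialY F z = 2 * dzBar f z := by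
    rw [dzBar]; simp only [partialX, partialY]; ring
  rw [hypLaplacian, hX, hY, hdef] at hL
  have hyc : (z.im : ℂ) ≠ 0 := by exact_mod_cast hy
  rw [map_eq_zero]
  have hsplit : (((z : ℂ).im ^ (2 * (1 - (k : ℤ))) : ℝ) : ℂ)
      = (((z : ℂ).im ^ (2 * (1 - (k : ℤ)) - 1) : ℝ) : ℂ) * z.im := by
    rw [← Complex.ofReal_mul]
    congr 1
    rw [zpow_sub_one₀ (show (z : ℂ).im ≠ 0 from hy)]
    rw [mul_assoc, show (z.im : ℝ) = (z : ℂ).im from rfl, inv_mul_cancel₀ (show (z : ℂ).im ≠ 0 from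
        hy),
      mul_one]
  rw [hsplit, Complex.ofReal_mul]
  set P := (((z : ℂ).im ^ (2 * (1 - (k : ℤ)) - 1) : ℝ) : ℂ)
  have hL2 : (z.im : ℂ) * (D 1 1 + D Complex.I Complex.I)
      = 4 * Complex.I * ((1 - k : ℤ) : ℂ) * dzBar f z := by
    apply mul_left_cancel₀ hyc
    linear_combination -hL
  push_cast at hL2 ⊢
  have hI : 1 / (2 * Complex.I) = -Complex.I / 2 := by
    rw [one_div, mul_inv, Complex.inv_I]; ring
  rw [hI]
  linear_combination P / 4 * hL2

/-! ### Comparison with the elliptic expansion -/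

theorem exists_mem_puncturedDisc {ϱ : ℍ} {R : ℝ} {w : ℂ} (hw : w ∈ annulus (min R 1)) :
    ∃ z ∈ puncturedDisc ϱ R, ellX ϱ z = w := by
  have h1 : ‖w‖ < 1 := hw.2.trans_le (min_le_right _ _)
  exact ⟨⟨discInv ϱ w, discInv_im_pos ϱ h1⟩,
    coe_mem_coePuncturedDisc.1 (discInv_mem_coePuncturedDisc hw), discCoord_discInv ϱ h1⟩

/-- The enumeration `l ↦ N - l` of the integers `n ≤ N`. -/
def natEquivIic (N : ℕ) : ℕ ≃ Set.Iic (N : ℤ) where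
  toFun l := ⟨N - (l : ℤ), by simp⟩
  invFun n := ((N : ℤ) - n).toNat
  left_inv l := by simp
  right_inv n := by
    have := n.2
    ext; simp only [Set.mem_Iic] at this ⊢; lia

theorem neg_succ_mem_betaZeroIndices (k n₀ m : ℕ) : (-((m : ℤ) + 1)) ∈ betaZeroIndices k n₀ := by
  refine ⟨by lia, fun h => ?_⟩
  have := h.1
  lia

section
variable {k n₀ : ℕ} {ϱ : ℍ} {R : ℝ} {F : ℍ → ℂ} {cPlus cMinus : ℤ → ℂ}

/-- The lower bound for `β₀` turns convergence of the elliptic expansion into convergence of the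
series for `ξ F`; the lost factor `m + 1` is regained by differentiation. -/
theorem HasEllipticExpansion.summableIic (hk : 1 ≤ k)
    (h : HasEllipticExpansion k n₀ ϱ R F cPlus cMinus) : SummableIic cMinus n₀ (min R 1) := by
  have h1 : ∀ r, 0 < r → r < min R 1 → Summable fun m : ℕ =>
      ‖cMinus (-((m : ℤ) + 1)) / ((m : ℂ) + 1)‖ * r ^ ((m : ℤ) + 1) := by
    intro r h0 hr
    have hr1 : r < 1 := hr.trans_le (min_le_right _ _)
    have hn : ‖(r : ℂ)‖ = r := by simp [abs_of_pos h0]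
    obtain ⟨z, hz, hzw⟩ := exists_mem_puncturedDisc (ϱ := ϱ) (R := R) (w := (r : ℂ))
      ⟨by exact_mod_cast h0.ne', by rwa [hn]⟩
    have hR : ellR ϱ z = r := by rw [ellR, hzw, hn]
    have hs := (h z hz).2.1.norm
    rw [hzw, hR] at hs
    have hinj : Function.Injective fun m : ℕ =>
        (⟨-((m : ℤ) + 1), neg_succ_mem_betaZeroIndices k n₀ m⟩ : betaZeroIndices k n₀) := by
      intro m m' hm
      simpa using hm
    have hs2 := (hs.comp_injective hinj).mul_left (((1 - r ^ 2) ^ (2 * k - 1 - 1))⁻¹)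
    refine Summable.of_nonneg_of_le (fun m => by positivity) (fun m => ?_) hs2
    have hr2 : r ^ 2 < 1 := by nlinarith
    have hβ := le_neg_incBetaZero (show 1 ≤ 2 * k - 1 by omega) m (pow_pos h0 2) hr2
    have hQ : 0 < (1 - r ^ 2) ^ (2 * k - 1 - 1) := pow_pos (by linarith) _
    simp only [Function.comp_apply, norm_mul, norm_zpow, hn, norm_div, neg_neg, Complex.norm_real]
    have hm : ‖(m : ℂ) + 1‖ = (m : ℝ) + 1 := by
      rw [← Nat.cast_add_one, Complex.norm_natCast]; push_cast; rfl
    rw [hm, inv_mul_eq_div, le_div_iff₀ hQ]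
    have hβ2 := hβ.trans (neg_le_abs _)
    rw [← Real.norm_eq_abs] at hβ2
    have hrz : r ^ ((m : ℤ) + 1) = r ^ (m + 1) := by exact_mod_cast zpow_natCast r (m + 1)
    rw [zpow_neg, hrz]
    calc _ = ‖cMinus (-((m : ℤ) + 1))‖ * ((1 - r ^ 2) ^ (2 * k - 1 - 1) *
          ((r ^ 2) ^ (m + 1) / ((m : ℝ) + 1))) * (r ^ (m + 1))⁻¹ := by
          field_simp; ring
      _ ≤ _ := by gcongr
  have h2 := summable_deriv_laurent (e := fun m : ℕ => (m : ℤ) + 1) h1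
  intro r h0 hr
  rw [← (natEquivIic n₀).summable_iff, ← summable_nat_add_iff (n₀ + 1)]
  refine ((h2 r h0 hr).mul_left r).congr fun m => ?_
  have hm : (m : ℂ) + 1 ≠ 0 := by exact_mod_cast Nat.succ_ne_zero m
  have e1 : ((natEquivIic n₀ (m + (n₀ + 1)) : Set.Iic (n₀ : ℤ)) : ℤ) = -((m : ℤ) + 1) := by
    simp [natEquivIic]; ring
  simp only [Function.comp_apply, e1]
  rw [neg_neg, add_sub_cancel_right, zpow_add_one₀ h0.ne']
  push_cast
  rw [div_mul_cancel₀ _ hm]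
  ring

theorem HasEllipticExpansion.summable_plus
    (h : HasEllipticExpansion k n₀ ϱ R F cPlus cMinus) : ∀ r, 0 < r → r < min R 1 →
      Summable fun n : Set.Ici (-(n₀ : ℤ)) => ‖cPlus n‖ * r ^ (n : ℤ) := by
  intro r h0 hr
  have hn : ‖(r : ℂ)‖ = r := by simp [abs_of_pos h0]
  obtain ⟨z, hz, hzw⟩ := exists_mem_puncturedDisc (ϱ := ϱ) (R := R) (w := (r : ℂ))
    ⟨by exact_mod_cast h0.ne', by rwa [hn]⟩
  have hs := (h z hz).1.norm
  rw [hzw] at hs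
  simpa only [norm_mul, norm_zpow, hn] using hs

/-- The polynomial by which expansions in `β` and in `β₀` differ. -/
noncomputable def betaPolynomial (a : ℕ) (c : ℤ → ℂ) (N : ℕ) (w : ℂ) : ℂ :=
  ∑ j ∈ Finset.range a, residueCoeff c N j * (betaConst a (-(j : ℤ)) : ℂ) * w ^ j

theorem sum_Icc_nK (hk : 1 ≤ k) (f : ℤ → ℂ) : ∑ n ∈ Finset.Icc (0 : ℤ) (nK k n₀), f n
    = ∑ j ∈ Finset.range (2 * k - 1), if j ≤ n₀ then f j else 0 := by
  rw [← Finset.sum_filter]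
  refine Finset.sum_nbij' Int.toNat (fun j => (j : ℤ)) ?_ ?_ ?_ ?_ ?_
  · intro n hn
    simp only [nK, Finset.mem_Icc, le_min_iff, Finset.mem_filter, Finset.mem_range] at hn ⊢
    omega
  · intro j hj
    simp only [nK, Finset.mem_Icc, le_min_iff, Finset.mem_filter, Finset.mem_range] at hj ⊢
    omega
  · intro n hn
    simp only [Finset.mem_Icc] at hn
    omega
  · intro j _; simp
  · intro n hn
    simp only [Finset.mem_Icc] at hn
    rw [Int.toNat_of_nonneg hn.1]

theorem hasSum_Iic_split {f : ℤ → ℂ} {S : ℂ} (hS : HasSum (fun n : Set.Iic (n₀ : ℤ) => f n) S) :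
    Summable (fun n : betaZeroIndices k n₀ => f n) ∧
      (∑ n ∈ Finset.Icc (0 : ℤ) (nK k n₀), f n) + ∑' n : betaZeroIndices k n₀, f n = S := by
  have hsub : betaZeroIndices k n₀ ⊆ Set.Iic (n₀ : ℤ) := fun n hn => hn.1
  have hsum : Summable fun n : betaZeroIndices k n₀ => f n :=
    hS.summable.comp_injective (Set.inclusion_injective hsub)
  have hunion : Set.Iic (n₀ : ℤ) = ↑(Finset.Icc (0 : ℤ) (nK k n₀)) ∪ betaZeroIndices k n₀ := by
    ext n
    simp only [betaZeroIndices, Set.mem_Iic, Finset.coe_Icc, Set.mem_union, Set.mem_Icc,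
      Set.mem_ofPred_eq, nK, le_min_iff]
    lia
  have hdisj : Disjoint (↑(Finset.Icc (0 : ℤ) (nK k n₀)) : Set ℤ) (betaZeroIndices k n₀) := by
    rw [Set.disjoint_left]
    intro n hn hn'
    exact hn'.2 (by simpa using hn)
  have htot := (Finset.hasSum (Finset.Icc (0 : ℤ) (nK k n₀)) f).add_disjoint hdisj hsum.hasSum
  rw [← hunion] at htot
  exact ⟨hsum, htot.unique hS⟩

/-- The parts of the elliptic expansion with `β` and with `β₀` add up to `nonholPart` and a
polynomial. -/
theorem hasSum_betaZero (hk : 1 ≤ k) {ρ : ℝ} (hρ : ρ ≤ 1) (hs : SummableIic cMinus n₀ ρ) {w : ℂ}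
    (hw : w ∈ annulus ρ) :
    Summable (fun n : betaZeroIndices k n₀ =>
      cMinus n * (incBetaZero (1 - ‖w‖ ^ 2) (2 * k - 1) (-(n : ℤ)) : ℂ) * w ^ (n : ℤ)) ∧
    (∑ n ∈ Finset.Icc (0 : ℤ) (nK k n₀),
        cMinus n * (incBeta (1 - ‖w‖ ^ 2) (2 * k - 1) (-n) : ℂ) * w ^ n)
      + ∑' n : betaZeroIndices k n₀,
        cMinus n * (incBetaZero (1 - ‖w‖ ^ 2) (2 * k - 1) (-(n : ℤ)) : ℂ) * w ^ (n : ℤ)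
      = nonholPart (2 * k - 1) cMinus n₀ w + betaPolynomial (2 * k - 1) cMinus n₀ w := by
  obtain ⟨f, hf⟩ : ∃ f : ℤ → ℂ, f = fun n =>
    cMinus n * (incBetaZero (1 - ‖w‖ ^ 2) (2 * k - 1) (-n) : ℂ) * w ^ n := ⟨_, rfl⟩
  have hS : HasSum (fun n : Set.Iic (n₀ : ℤ) => f n) (nonholPart (2 * k - 1) cMinus n₀ w) := by
    rw [hf]; exact hasSum_nonholPart hs hρ (by omega) hw
  obtain ⟨hsum, heq⟩ := hasSum_Iic_split (k := k) hS
  have hfn : ∀ n : ℤ, cMinus n * (incBetaZero (1 - ‖w‖ ^ 2) (2 * k - 1) (-n) : ℂ) * w ^ n = f n :=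
    fun n => by rw [hf]
  simp only [hfn]
  refine ⟨hsum, ?_⟩
  have hβ : ∑ n ∈ Finset.Icc (0 : ℤ) (nK k n₀),
      cMinus n * (incBeta (1 - ‖w‖ ^ 2) (2 * k - 1) (-n) : ℂ) * w ^ n
      = ∑ n ∈ Finset.Icc (0 : ℤ) (nK k n₀), f n
        + ∑ n ∈ Finset.Icc (0 : ℤ) (nK k n₀), cMinus n * (betaConst (2 * k - 1) (-n) : ℂ) * w ^ n
            := by
    rw [← Finset.sum_add_distrib]
    refine Finset.sum_congr rfl fun n _ => ?_
    simp only [hf, incBetaZero]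
    push_cast; ring
  have hpoly : ∑ n ∈ Finset.Icc (0 : ℤ) (nK k n₀), cMinus n * (betaConst (2 * k - 1) (-n) : ℂ) * w
      ^ n
      = betaPolynomial (2 * k - 1) cMinus n₀ w := by
    rw [sum_Icc_nK hk, betaPolynomial]
    refine Finset.sum_congr rfl fun j _ => ?_
    rw [residueCoeff]
    split_ifs <;> simp
  rw [hβ, hpoly, ← heq]
  ring

/-- The factor of `(z - ϱ̄) ^ (2k - 2)` in the elliptic expansion, in the disc coordinate. -/
noncomputable def discExpansion (k n₀ : ℕ) (cPlus cMinus : ℤ → ℂ) (w : ℂ) : ℂ :=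
  (∑' n : Set.Ici (-(n₀ : ℤ)), cPlus n * w ^ (n : ℤ))
    + (nonholPart (2 * k - 1) cMinus n₀ w + betaPolynomial (2 * k - 1) cMinus n₀ w)

/-- An expansion in the disc coordinate is an elliptic expansion. -/
theorem hasEllipticExpansion_of_disc (hk : 1 ≤ k) (hs : SummableIic cMinus n₀ (min R 1))
    (hP : ∀ w ∈ annulus (min R 1), Summable fun n : Set.Ici (-(n₀ : ℤ)) => cPlus n * w ^ (n : ℤ))
    (hF : ∀ z ∈ puncturedDisc ϱ R, F z = ((z : ℂ) - conj (ϱ : ℂ)) ^ (2 * k - 2) *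
      discExpansion k n₀ cPlus cMinus (ellX ϱ z)) :
    HasEllipticExpansion k n₀ ϱ R F cPlus cMinus := by
  intro z hz
  have hw : ellX ϱ z ∈ annulus (min R 1) := (coe_mem_coePuncturedDisc.2 hz).2
  obtain ⟨h1, h2⟩ := hasSum_betaZero hk (min_le_right _ _) hs hw
  refine ⟨hP _ hw, h1, ?_⟩
  rw [hF z hz, discExpansion, ← h2, add_assoc]
  rfl

theorem HasEllipticExpansion.eq_disc (hk : 1 ≤ k)
    (h : HasEllipticExpansion k n₀ ϱ R F cPlus cMinus) {z : ℍ} (hz : z ∈ puncturedDisc ϱ R) :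
    F z = ((z : ℂ) - conj (ϱ : ℂ)) ^ (2 * k - 2) * discExpansion k n₀ cPlus cMinus (ellX ϱ z) := by
  have hw : ellX ϱ z ∈ annulus (min R 1) := (coe_mem_coePuncturedDisc.2 hz).2
  have h2 := (hasSum_betaZero hk (min_le_right _ _) (h.summableIic hk) hw).2
  rw [(h z hz).2.2, discExpansion, ← h2, add_assoc]
  rfl

theorem contDiffOn_betaPolynomial (a : ℕ) (c : ℤ → ℂ) (N : ℕ) (s : Set ℂ) :
    ContDiffOn ℝ ∞ (betaPolynomial a c N) s :=
  ContDiffOn.sum fun j _ => contDiffOn_const.mul (contDiffOn_id.pow j)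

theorem HasEllipticExpansion.contDiffOn_disc (hk : 1 ≤ k)
    (h : HasEllipticExpansion k n₀ ϱ R F cPlus cMinus) :
    ContDiffOn ℝ ∞ (discExpansion k n₀ cPlus cMinus) (annulus (min R 1)) :=
  (contDiffOn_laurent h.summable_plus).add ((contDiffOn_nonholPart (h.summableIic hk) _).add
    (contDiffOn_betaPolynomial _ _ _ _))

theorem HasEllipticExpansion.dzBar_disc (hk : 1 ≤ k)
    (h : HasEllipticExpansion k n₀ ϱ R F cPlus cMinus) {w : ℂ} (hw : w ∈ annulus (min R 1)) :
    dzBar (discExpansion k n₀ cPlus cMinus) w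
      = -(((1 - Complex.normSq w) ^ (2 * k - 2) : ℝ) : ℂ) * conj (xiSeries cMinus n₀ w) := by
  have h1 := HasWirtingerAt.of_hasDerivAt (hasDerivAt_laurent h.summable_plus hw)
  have h2 := hasWirtingerAt_nonholPart (h.summableIic hk) (show 1 ≤ 2 * k - 1 by omega) hw
  have h3 : HasWirtingerAt (betaPolynomial (2 * k - 1) cMinus n₀) _ _ w :=
    HasWirtingerAt.sum fun j _ => (HasWirtingerAt.of_hasDerivAt (hasDerivAt_pow j w)).const_mul
      (residueCoeff cMinus n₀ j * (betaConst (2 * k - 1) (-(j : ℤ)) : ℂ))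
  have h4 : HasWirtingerAt (discExpansion k n₀ cPlus cMinus) _ _ w := h1.add (h2.add h3)
  rw [h4.dzBar_eq]
  simp only [mul_zero, Finset.sum_const_zero, add_zero, zero_add]
  rw [show 2 * k - 1 - 1 = 2 * k - 2 by omega]

theorem iterate_dz_betaPolynomial (a : ℕ) (c : ℤ → ℂ) (N : ℕ) {ρ : ℝ} :
    Set.EqOn (dz^[a] (betaPolynomial a c N)) (fun _ => 0) (annulus ρ) := by
  intro w hw
  have ho := isOpen_annulus ρ
  have hsm : ∀ j : ℕ, ContDiffOn ℝ ∞ (fun w : ℂ => w ^ j) (annulus ρ) := fun j => contDiffOn_id.pow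
      j
  have h0 : dz^[a] (betaPolynomial a c N) w = _ := iterate_dz_sum ho (Finset.range a)
    (f := fun j w => residueCoeff c N j * (betaConst a (-(j : ℤ)) : ℂ) * w ^ j)
    (fun j _ => contDiffOn_const.mul (hsm j)) a hw
  rw [h0]
  refine Finset.sum_eq_zero fun j hj => ?_
  rw [iterate_dz_const_mul ho (hsm j) _ a hw]
  simp only
  rw [iterate_dz_pow_eq_zero (Finset.mem_range.1 hj) hw, mul_zero]

theorem prod_neg_sub_mul_factorial (m a : ℕ) :
    (∏ l ∈ Finset.range a, ((-((m : ℂ) + 1)) - l)) * m.factorial = (-1) ^ a * (m + a).factorial :=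
        by
  induction a with
  | zero => simp
  | succ a ih =>
    rw [Finset.prod_range_succ, mul_right_comm, ih, ← add_assoc, Nat.factorial_succ]
    push_cast; ring

theorem prod_sub_mul_factorial {M b : ℕ} (hb : b ≤ M) :
    (∏ l ∈ Finset.range b, ((M : ℂ) - l)) * (M - b).factorial = M.factorial := by
  induction b with
  | zero => simp
  | succ b ih =>
    rw [← ih (by omega), Finset.prod_range_succ, show M - b = M - (b + 1) + 1 by omega,
      Nat.factorial_succ, show M - (b + 1) + 1 = M - b by omega, mul_assoc]
    push_cast [Nat.cast_sub (show b ≤ M by omega)]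
    rfl

/-- The coefficient `b(n)` collects the `(2k-1)`-st derivative of `c⁺(n) w ^ n` and the
contribution of
the logarithm; the product vanishes for `0 ≤ n ≤ 2k - 2`. -/
theorem bCoeff_eq (hk : 1 ≤ k) (n : ℤ) : bCoeff k n₀ cPlus cMinus n
    = cPlus n * ∏ l ∈ Finset.range (2 * k - 1), ((n : ℂ) - l)
      + -((2 * k - 2).factorial : ℂ) *
        ∑ j ∈ Finset.range (2 * k - 1), if (j : ℤ) = n then residueCoeff cMinus n₀ j else 0 := by
  have hsum0 : (¬ (0 ≤ n ∧ n ≤ nK k n₀)) →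
      ∑ j ∈ Finset.range (2 * k - 1), (if (j : ℤ) = n then residueCoeff cMinus n₀ j else 0) = 0 :=
          by
    intro hn
    refine Finset.sum_eq_zero fun j hj => ?_
    rw [Finset.mem_range] at hj
    split_ifs with h
    · rw [residueCoeff, if_neg]
      intro hjn
      apply hn
      simp only [nK, le_min_iff]
      omega
    · rfl
  have hprod0 : 0 ≤ n → n ≤ 2 * (k : ℤ) - 2 →
      ∏ l ∈ Finset.range (2 * k - 1), ((n : ℂ) - l) = 0 := by
    intro h0 h1
    refine Finset.prod_eq_zero (i := n.toNat) (Finset.mem_range.2 (by omega)) ?_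
    have : ((n.toNat : ℕ) : ℂ) = ((n.toNat : ℤ) : ℂ) := by push_cast; rfl
    rw [this, Int.toNat_of_nonneg h0, sub_self]
  have hK : nK k n₀ ≤ 2 * (k : ℤ) - 2 := min_le_left _ _
  have hK2 : nK k n₀ ≤ (n₀ : ℤ) := min_le_right _ _
  unfold bCoeff
  split_ifs with h1 h2 h3
  · rw [hsum0 (by omega), mul_zero, add_zero]
    obtain ⟨m, rfl⟩ : ∃ m : ℕ, n = -((m : ℤ) + 1) := ⟨(-n - 1).toNat, by omega⟩
    have hp := prod_neg_sub_mul_factorial m (2 * k - 1)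
    have hm : (m.factorial : ℂ) ≠ 0 := by exact_mod_cast m.factorial_ne_zero
    have hodd : (-1 : ℂ) ^ (2 * k - 1) = -1 := Odd.neg_one_pow ⟨k - 1, by omega⟩
    rw [hodd] at hp
    rw [show (- -((m : ℤ) + 1) + 2 * (k : ℤ) - 2).toNat = m + (2 * k - 1) by omega,
      show (- -((m : ℤ) + 1) - 1).toNat = m by omega]
    push_cast
    field_simp
    linear_combination -cPlus (-((m : ℤ) + 1)) * hp
  · rw [hprod0 (by omega) (by omega), mul_zero, zero_add]
    congr 1
    obtain ⟨j, rfl⟩ : ∃ j : ℕ, n = j := ⟨n.toNat, by omega⟩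
    rw [Finset.sum_eq_single j]
    · rw [if_pos rfl, residueCoeff, if_pos (by omega)]
    · intro i _ hi
      rw [if_neg (by exact_mod_cast hi)]
    · intro hj
      rw [Finset.mem_range] at hj
      omega
  · rw [hsum0 (by omega), mul_zero, add_zero]
    obtain ⟨M, rfl⟩ : ∃ M : ℕ, n = M := ⟨n.toNat, by omega⟩
    have hp := prod_sub_mul_factorial (M := M) (b := 2 * k - 1) (by omega)
    rw [show ((M : ℤ) + 1 - 2 * (k : ℤ)).toNat = M - (2 * k - 1) by omega, Int.toNat_natCast]
    have hm : ((M - (2 * k - 1)).factorial : ℂ) ≠ 0 := by exact_mod_cast Nat.factorial_ne_zero _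
    push_cast
    field_simp
    linear_combination -cPlus M * hp
  · rw [hsum0 (by omega), hprod0 (by omega) (by omega)]
    simp

theorem HasEllipticExpansion.hasSum_iterate_dz (hk : 1 ≤ k)
    (h : HasEllipticExpansion k n₀ ϱ R F cPlus cMinus) {w : ℂ} (hw : w ∈ annulus (min R 1)) :
    HasSum (fun n : Set.Ici (-(n₀ : ℤ)) =>
      bCoeff k n₀ cPlus cMinus n * w ^ ((n : ℤ) + 1 - 2 * (k : ℤ)))
      (dz^[2 * k - 1] (discExpansion k n₀ cPlus cMinus) w) := by
  have ho := isOpen_annulus (min R 1)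
  have hs := h.summableIic hk
  obtain ⟨hA, hA2⟩ := iterate_dz_laurent h.summable_plus (2 * k - 1)
  have e1 : dz^[2 * k - 1] (discExpansion k n₀ cPlus cMinus) w = _ :=
    iterate_dz_add ho (contDiffOn_laurent h.summable_plus) ((contDiffOn_nonholPart hs _).add
      (contDiffOn_betaPolynomial (2 * k - 1) cMinus n₀ _)) (2 * k - 1) hw
  have e2 := iterate_dz_add ho (contDiffOn_nonholPart hs (2 * k - 1))
    (contDiffOn_betaPolynomial (2 * k - 1) cMinus n₀ _) (2 * k - 1) hw
  rw [e1]
  simp only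
  rw [hA2 hw, e2]
  simp only
  rw [iterate_dz_nonholPart hs _ hw, iterate_dz_betaPolynomial _ _ _ hw, add_zero]
  have hsA : Summable fun n : Set.Ici (-(n₀ : ℤ)) =>
      cPlus n * (∏ l ∈ Finset.range (2 * k - 1), (((n : ℤ) : ℂ) - l))
        * w ^ ((n : ℤ) - ((2 * k - 1 : ℕ) : ℤ)) := by
    refine Summable.of_norm ?_
    simpa only [norm_mul, norm_zpow] using hA ‖w‖ (norm_pos_iff.2 hw.1) hw.2
  have hfin := hasSum_sum (s := Finset.range (2 * k - 1)) fun j (_ : j ∈ Finset.range (2 * k - 1))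
      =>
    hasSum_ite_natCast (s := Set.Ici (-(n₀ : ℤ))) j
      (residueCoeff cMinus n₀ j * w ^ ((j : ℤ) - ((2 * k - 1 : ℕ) : ℤ)))
  have htot := hsA.hasSum.add (hfin.mul_left (-((-1) ^ (2 * k - 1 - 1) * ((2 * k - 1 - 1).factorial
      : ℂ))))
  convert! htot using 1
  · funext n
    have hev : (-1 : ℂ) ^ (2 * k - 1 - 1) = 1 := Even.neg_one_pow ⟨k - 1, by omega⟩
    rw [bCoeff_eq hk, hev, one_mul, show 2 * k - 1 - 1 = 2 * k - 2 by omega,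
      show (n : ℤ) + 1 - 2 * (k : ℤ) = (n : ℤ) - ((2 * k - 1 : ℕ) : ℤ) by omega, add_mul, mul_assoc
          (-_),
      Finset.sum_mul]
    congr 2
    refine Finset.sum_congr rfl fun j _ => ?_
    split_ifs with hj
    · rw [hj]
    · rw [zero_mul]
  · have hmem : ∀ j : ℕ, (j : ℤ) ∈ Set.Ici (-(n₀ : ℤ)) := fun j => by
      simp only [Set.mem_Ici]; lia
    simp only [hmem, if_true]

end

/-! ### Images under `ξ` and `D^{2k-1}` -/

theorem ellX_mem_annulus {ϱ z : ℍ} {R : ℝ} (hz : z ∈ puncturedDisc ϱ R) :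
    ellX ϱ z ∈ annulus (min R 1) := (coe_mem_coePuncturedDisc.2 hz).2

section
variable {k n₀ : ℕ} {ϱ : ℍ} {R : ℝ} {F : ℍ → ℂ} {cPlus cMinus : ℤ → ℂ}

theorem HasEllipticExpansion.eqOn_coe (hk : 1 ≤ k)
    (h : HasEllipticExpansion k n₀ ϱ R F cPlus cMinus) :
    Set.EqOn (F ∘ UpperHalfPlane.ofComplex) (fun z => (z - conj (ϱ : ℂ)) ^ (2 * k - 2) *
      discExpansion k n₀ cPlus cMinus (discCoord ϱ z)) (coePuncturedDisc ϱ R) := by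
  intro z hz
  have hz0 : 0 < z.im := hz.1
  have h1 := h.eq_disc hk (z := ⟨z, hz0⟩) (coe_mem_coePuncturedDisc.1 hz)
  rw [Function.comp_apply, UpperHalfPlane.ofComplex_apply_of_im_pos hz0, h1]
  rfl

theorem contDiffOn_discCoord (ϱ : ℍ) (R : ℝ) :
    ContDiffOn ℝ ∞ (discCoord ϱ) (coePuncturedDisc ϱ R) := by
  have h1 : DifferentiableOn ℂ (discCoord ϱ) (coePuncturedDisc ϱ R) := fun z hz =>
    (hasDerivAt_discCoord ϱ hz.1).differentiableAt.differentiableWithinAt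
  exact (h1.contDiffOn (isOpen_coePuncturedDisc ϱ R)).restrict_scalars ℝ

theorem HasEllipticExpansion.contDiffOn_coe (hk : 1 ≤ k)
    (h : HasEllipticExpansion k n₀ ϱ R F cPlus cMinus) :
    ContDiffOn ℝ ∞ (F ∘ UpperHalfPlane.ofComplex) (coePuncturedDisc ϱ R) :=
  ContDiffOn.congr (((contDiffOn_sub_const _ _).pow _).mul ((h.contDiffOn_disc hk).comp
    (contDiffOn_discCoord ϱ R) fun _ hz => hz.2)) (h.eqOn_coe hk)

theorem HasEllipticExpansion.xi_eq (hk : 1 ≤ k)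
    (h : HasEllipticExpansion k n₀ ϱ R F cPlus cMinus) {z : ℍ} (hz : z ∈ puncturedDisc ϱ R) :
    xi (1 - (k : ℤ)) F z = (4 * (ϱ.im : ℂ)) ^ (2 * k - 1) *
      ((z : ℂ) - conj (ϱ : ℂ)) ^ (-(2 * (k : ℤ))) * xiSeries cMinus n₀ (ellX ϱ z) := by
  have hzU := coe_mem_coePuncturedDisc.2 hz
  have ho := isOpen_coePuncturedDisc ϱ R
  have hz0 : 0 < (z : ℂ).im := hzU.1
  have hne := sub_conj_ne_zero ϱ hz0
  have hW := ((HasWirtingerAt.of_hasDerivAt (((hasDerivAt_id (z : ℂ)).sub_const (conj (ϱ : ℂ))).pow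
    (2 * k - 2))).mul (((h.contDiffOn_disc hk).hasWirtingerAt (isOpen_annulus _) hzU.2).comp
      (hasDerivAt_discCoord ϱ hz0))).congr_of_eventuallyEq
        ((h.eqOn_coe hk).eventuallyEq_of_mem (ho.mem_nhds hzU))
  have h1 : partialZBar F z = dzBar (F ∘ UpperHalfPlane.ofComplex) z := rfl
  rw [xi, h1, hW.dzBar_eq, h.dzBar_disc hk hzU.2, one_sub_normSq_discCoord ϱ hz0]
  obtain ⟨m, rfl⟩ : ∃ m, k = m + 1 := ⟨k - 1, by omega⟩
  have hy : (z.im : ℂ) ≠ 0 := by exact_mod_cast z.im_pos.ne'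
  have hX : discCoord ϱ (z : ℂ) = ellX ϱ z := rfl
  have hq := (map_ne_zero (starRingEnd ℂ)).2 hne
  set q : ℂ := (z : ℂ) - conj (ϱ : ℂ)
  have e1 : (z.im : ℂ) ^ (2 * (1 - ((m + 1 : ℕ) : ℤ))) = ((z.im : ℂ) ^ (2 * m))⁻¹ := by
    rw [← zpow_natCast, ← zpow_neg]; congr 1; push_cast; ring
  have e2 : q ^ (-(2 * ((m + 1 : ℕ) : ℤ))) = (q ^ (2 * m + 2))⁻¹ := by
    rw [← zpow_natCast, ← zpow_neg]; congr 1
  have e3 : ((((4 * ϱ.im * (z : ℂ).im / Complex.normSq q) ^ (2 * (m + 1) - 2) : ℝ)) : ℂ)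
      = (4 * ϱ.im * z.im / (q * conj q)) ^ (2 * m) := by
    rw [show 2 * (m + 1) - 2 = 2 * m by omega, Complex.mul_conj]; push_cast; rfl
  rw [e1, e2, e3, hX, show 2 * (m + 1) - 2 = 2 * m by omega,
    show 2 * (m + 1) - 1 = 2 * m + 1 by omega]
  simp only [zero_mul, zero_add, map_mul, map_neg, map_pow, map_div₀, map_inv₀, Complex.conj_conj,
    Complex.conj_I, Complex.conj_ofReal, Complex.conj_ofNat, Pi.pow_apply]
  have e4 : id (z : ℂ) - conj (ϱ : ℂ) = q := rfl
  rw [e4, div_pow, mul_pow _ (z.im : ℂ), mul_pow (conj q), neg_neg]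
  field_simp
  rw [Complex.I_sq]
  ring

theorem HasEllipticExpansion.iterD_eq (hk : 1 ≤ k)
    (h : HasEllipticExpansion k n₀ ϱ R F cPlus cMinus) {z : ℍ} (hz : z ∈ puncturedDisc ϱ R) :
    iterD (2 * k - 1) F z = ((ϱ.im : ℂ) / (Real.pi : ℂ)) ^ (2 * k - 1)
      * ((z : ℂ) - conj (ϱ : ℂ)) ^ (-(2 * (k : ℤ))) *
        dz^[2 * k - 1] (discExpansion k n₀ cPlus cMinus) (ellX ϱ z) := by
  have hzU := coe_mem_coePuncturedDisc.2 hz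
  have ho := isOpen_coePuncturedDisc ϱ R
  have ha : conj (ϱ : ℂ) ∉ coePuncturedDisc ϱ R := fun hmem => by
    have h1 : 0 < (conj (ϱ : ℂ)).im := hmem.1
    have := ϱ.im_pos
    simp at h1
    linarith
  have hbol := bol_identity ho (isOpen_annulus (min R 1)) ha
    (fun z hz => hasDerivAt_discCoord ϱ hz.1) (fun z hz => hz.2) (h.contDiffOn_disc hk) (2 * k - 2)
        hzU
  rw [show 2 * k - 2 + 1 = 2 * k - 1 by omega, show 2 * k - 2 + 2 = 2 * k by omega] at hbol
  rw [iterD_eq_iterate_dz, iterate_dz_eqOn ho (h.eqOn_coe hk) (2 * k - 1) hzU, hbol]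
  have e2 : ((z : ℂ) - conj (ϱ : ℂ)) ^ (-(2 * (k : ℤ))) = (((z : ℂ) - conj (ϱ : ℂ)) ^ (2 * k))⁻¹ :=
      by
    rw [← zpow_natCast, ← zpow_neg]; congr 1
  have e3 : (ϱ.im : ℂ) / (Real.pi : ℂ)
      = 1 / (2 * (Real.pi : ℂ) * Complex.I) * (2 * Complex.I * ϱ.im) := by
    have := Complex.I_ne_zero
    have : (Real.pi : ℂ) ≠ 0 := by exact_mod_cast Real.pi_ne_zero
    field_simp
  simp only
  rw [e2, e3, mul_pow _ (2 * Complex.I * (ϱ.im : ℂ)), show discCoord ϱ (z : ℂ) = ellX ϱ z from rfl]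
  simp only [mul_assoc]

end

/-! ### Existence of the elliptic expansion -/

theorem exists_ellipticExpansion {k : ℕ} (hk : 1 ≤ k) (ϱ : ℍ) (n₀ : ℕ) {R : ℝ} (hR : 0 < R)
    {F : ℍ → ℂ} (hF : IsHarmonicOn (1 - (k : ℤ)) F (puncturedDisc ϱ R))
    (hbdd : (fun z : ℍ => (ellR ϱ z : ℂ) ^ n₀ * F z) =O[𝓝[≠] ϱ] (fun _ => (1 : ℝ))) :
    ∃ cPlus cMinus : ℤ → ℂ, HasEllipticExpansion k n₀ ϱ R F cPlus cMinus := by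
  set ρ := min R 1
  have hρ : 0 < ρ := lt_min hR one_pos
  have hlt : ∀ w ∈ annulus ρ, ‖w‖ < 1 := fun w hw => hw.2.trans_le (min_le_right _ _)
  set f := F ∘ UpperHalfPlane.ofComplex
  set φ := discInv ϱ
  set q := conj (ϱ : ℂ)
  have hφU : ∀ w ∈ annulus ρ, φ w ∈ coePuncturedDisc ϱ R := fun w hw =>
    discInv_mem_coePuncturedDisc hw
  have hharm : ∀ v ∈ coePuncturedDisc ϱ R, ∃ z : ℍ, (z : ℂ) = v ∧ z ∈ puncturedDisc ϱ R :=
    fun v hv => ⟨⟨v, hv.1⟩, rfl, coe_mem_coePuncturedDisc.1 hv⟩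
  set G : ℂ → ℂ := fun v => conj ((((v.im : ℝ) ^ (2 * (1 - (k : ℤ))) : ℝ) : ℂ) * dzBar f v)
  have hG : ∀ v ∈ coePuncturedDisc ϱ R, DifferentiableAt ℂ G v := fun v hv => by
    obtain ⟨z, rfl, hz⟩ := hharm v hv
    exact differentiableAt_conj_dzBar hF hz
  have hf : ∀ v ∈ coePuncturedDisc ϱ R, HasWirtingerAt f (dz f v) (dzBar f v) v := fun v hv => by
    obtain ⟨z, rfl, hz⟩ := hharm v hv
    exact hasWirtingerAt_dz ((hF z hz).1.differentiableAt (by simp))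
  set H : ℂ → ℂ := fun w => ((φ w - q) ^ (2 * k - 2))⁻¹ * f (φ w)
  -- With `1 - |w|² = 4 η y / |z - ϱ̄|²`, this `Ψ` solves `∂H/∂w̄ = -(1 - |w|²) ^ (2k - 2) conj Ψ`.
  set Ψ : ℂ → ℂ := fun w => -((4 * (ϱ.im : ℂ)) ^ (2 * k - 2))⁻¹ * (φ w - q) ^ (2 * k - 2) *
    (2 * Complex.I * ϱ.im / (1 - w) ^ 2) * G (φ w)
  have hφd : ∀ w ∈ annulus ρ, HasDerivAt φ (2 * Complex.I * ϱ.im / (1 - w) ^ 2) w := fun w hw =>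
    hasDerivAt_discInv ϱ (hlt w hw)
  have hΨ : DifferentiableOn ℂ Ψ (annulus ρ) := by
    intro w hw
    have h1 := one_sub_ne_zero_of_norm_lt (hlt w hw)
    have h2 := (hφd w hw).differentiableAt
    refine DifferentiableAt.differentiableWithinAt ?_
    refine ((((h2.sub_const q).pow _).const_mul _).mul ?_).mul ((hG _ (hφU w hw)).comp w h2)
    exact (differentiableAt_const _).div ((differentiableAt_id.const_sub 1).pow 2) (pow_ne_zero 2
        h1)
  have hH : ∀ w ∈ annulus ρ, HasWirtingerAt H (dz H w)
      (-(((1 - Complex.normSq w) ^ (2 * k - 1 - 1) : ℝ) : ℂ) * conj (Ψ w)) w := by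
    intro w hw
    have hv := hφU w hw
    have hne := sub_conj_ne_zero ϱ hv.1
    have h1 := HasWirtingerAt.of_hasDerivAt ((((hφd w hw).sub_const q).pow (2 * k - 2)).inv
      (pow_ne_zero _ hne))
    have h2 := h1.mul ((hf _ hv).comp (hφd w hw))
    refine HasWirtingerAt.congr_val h2 h2.dz_eq.symm ?_
    have h3 := one_sub_normSq_discCoord ϱ hv.1
    rw [discCoord_discInv ϱ (hlt w hw)] at h3
    have hy : ((φ w).im : ℂ) ≠ 0 := by exact_mod_cast (show 0 < (φ w).im from hv.1).ne'
    have hη : (ϱ.im : ℂ) ≠ 0 := by exact_mod_cast ϱ.im_pos.ne'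
    have hcne := (map_ne_zero (starRingEnd ℂ)).2 hne
    rw [h3]
    simp only [Ψ, G, Pi.inv_apply, Pi.pow_apply, Pi.inv_apply]
    change φ w - q ≠ 0 at hne
    change conj (φ w - q) ≠ 0 at hcne
    generalize 2 * Complex.I * (ϱ.im : ℂ) / (1 - w) ^ 2 = d
    obtain ⟨m, rfl⟩ : ∃ m, k = m + 1 := ⟨k - 1, by omega⟩
    have e1 : (((φ w).im ^ (2 * (1 - ((m + 1 : ℕ) : ℤ))) : ℝ) : ℂ) = (((φ w).im : ℂ) ^ (2 * m))⁻¹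
        := by
      rw [Complex.ofReal_zpow, ← zpow_natCast, ← zpow_neg]; congr 1; push_cast; ring
    have e3 : ((((4 * ϱ.im * (φ w).im / Complex.normSq (φ w - q)) ^ (2 * m) : ℝ)) : ℂ)
        = (4 * ϱ.im * (φ w).im / ((φ w - q) * conj (φ w - q))) ^ (2 * m) := by
      rw [Complex.mul_conj]; push_cast; rfl
    rw [show 2 * (m + 1) - 1 - 1 = 2 * m by omega, show 2 * (m + 1) - 2 = 2 * m by omega, e3, e1]
    simp only [map_mul, map_neg, map_inv₀, map_pow, Complex.conj_conj, Complex.conj_ofReal,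
      Complex.conj_ofNat]
    rw [div_pow, mul_pow _ ((φ w).im : ℂ), mul_pow (φ w - q)]
    field_simp
    ring
  obtain ⟨ε, hε, M, hM⟩ : ∃ ε > 0, ∃ M, ∀ w ∈ annulus ε, ‖w‖ ^ n₀ * ‖H w‖ ≤ M := by
    set T : ℂ → ℍ := fun w => UpperHalfPlane.ofComplex (φ w)
    have hTφ : ∀ w : ℂ, ‖w‖ < 1 → (T w : ℂ) = φ w := fun w hw => by
      simp only [T]
      rw [UpperHalfPlane.ofComplex_apply_of_im_pos (discInv_im_pos ϱ hw)]
    have hX : ∀ w : ℂ, ‖w‖ < 1 → ellX ϱ (T w) = w := fun w hw => by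
      rw [ellX, hTφ w hw]; exact discCoord_discInv ϱ hw
    have hφ0 : φ 0 = ϱ := by simp [φ, discInv]
    have h01 : ‖(0 : ℂ)‖ < 1 := by simp
    have hφc : ContinuousAt φ 0 := (hasDerivAt_discInv ϱ h01).continuousAt
    have hball : ∀ᶠ w : ℂ in 𝓝[≠] 0, ‖w‖ < 1 :=
      Filter.eventually_of_mem (annulus_mem_nhdsWithin one_pos) fun w hw => hw.2
    have hT : Filter.Tendsto T (𝓝[≠] 0) (𝓝[≠] ϱ) := by
      refine tendsto_nhdsWithin_iff.2 ⟨?_, ?_⟩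
      · rw [UpperHalfPlane.isOpenEmbedding_coe.tendsto_nhds_iff]
        have h1 : Filter.Tendsto φ (𝓝[≠] 0) (𝓝 (ϱ : ℂ)) := by
          rw [← hφ0]; exact hφc.tendsto.mono_left nhdsWithin_le_nhds
        refine h1.congr' ?_
        filter_upwards [hball] with w hw using (hTφ w hw).symm
      · filter_upwards [hball, self_mem_nhdsWithin] with w hw hw0 hTw
        apply hw0
        rw [Set.mem_singleton_iff] at hTw ⊢
        rw [← hX w hw, hTw]
        simp [ellX]
    have h1 := hbdd.comp_tendsto hT
    have h2 : (fun w => ((φ w - q) ^ (2 * k - 2))⁻¹) =O[𝓝[≠] 0] fun _ => (1 : ℝ) := by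
      have hne : (φ 0 - q) ^ (2 * k - 2) ≠ 0 :=
        pow_ne_zero _ (sub_conj_ne_zero ϱ (discInv_im_pos ϱ h01))
      exact ((((hφc.sub continuousAt_const).pow (2 * k - 2)).inv₀ hne).tendsto.mono_left
        nhdsWithin_le_nhds).isBigO_one ℝ
    obtain ⟨M, hM⟩ := (h1.mul h2).bound
    obtain ⟨ε, hε, hsub⟩ := Metric.mem_nhdsWithin_iff.1 hM
    refine ⟨min ε 1, lt_min hε one_pos, M, fun w hw => ?_⟩
    have hw1 : ‖w‖ < 1 := hw.2.trans_le (min_le_right _ _)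
    have h3 := hsub ⟨by simpa using hw.2.trans_le (min_le_left _ _), hw.1⟩
    simp only [Set.mem_ofPred_eq, Function.comp_apply, norm_mul, norm_pow, Complex.norm_real, ellR,
      hX w hw1, norm_norm, norm_one, mul_one] at h3
    rw [norm_mul, mul_comm ‖((φ w - q) ^ (2 * k - 2))⁻¹‖, ← mul_assoc]
    exact h3
  obtain ⟨cP, cM, hs, hsum⟩ := exists_disc_expansion (a := 2 * k - 1) (by omega) hρ hε hH hΨ hM
  -- The polynomial by which `β` and `β₀` differ is moved into `c⁺`.
  refine ⟨fun n => cP n - ∑ j ∈ Finset.range (2 * k - 1), if (j : ℤ) = n then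
    residueCoeff cM n₀ j * (betaConst (2 * k - 1) (-(j : ℤ)) : ℂ) else 0, cM, ?_⟩
  have hsum2 : ∀ w ∈ annulus ρ, HasSum (fun n : Set.Ici (-(n₀ : ℤ)) =>
      (cP n - ∑ j ∈ Finset.range (2 * k - 1), if (j : ℤ) = n then
        residueCoeff cM n₀ j * (betaConst (2 * k - 1) (-(j : ℤ)) : ℂ) else 0) * w ^ (n : ℤ))
      (H w - nonholPart (2 * k - 1) cM n₀ w - betaPolynomial (2 * k - 1) cM n₀ w) := by
    intro w hw
    have hfin : HasSum (fun n : Set.Ici (-(n₀ : ℤ)) => ∑ j ∈ Finset.range (2 * k - 1),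
        if (j : ℤ) = n then residueCoeff cM n₀ j * (betaConst (2 * k - 1) (-(j : ℤ)) : ℂ) * w ^ j
          else 0) (betaPolynomial (2 * k - 1) cM n₀ w) := by
      refine hasSum_sum fun j _ => ?_
      have := hasSum_ite_natCast (s := Set.Ici (-(n₀ : ℤ))) j
        (residueCoeff cM n₀ j * (betaConst (2 * k - 1) (-(j : ℤ)) : ℂ) * w ^ j)
      rwa [if_pos (by simp only [Set.mem_Ici]; lia)] at this
    convert! (hsum w hw).sub hfin using 1
    funext n
    rw [sub_mul, Finset.sum_mul]
    congr 1
    refine Finset.sum_congr rfl fun j _ => ?_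
    split_ifs with hj
    · rw [← hj, zpow_natCast]
    · rw [zero_mul]
  refine hasEllipticExpansion_of_disc hk hs (fun w hw => (hsum2 w hw).summable) fun z hz => ?_
  have hzU := coe_mem_coePuncturedDisc.2 hz
  rw [discExpansion, (hsum2 _ (ellX_mem_annulus hz)).tsum_eq]
  have hne := sub_conj_ne_zero ϱ hzU.1
  have hφz : φ (ellX ϱ z) = z := by
    have h1 := one_sub_ne_zero_of_norm_lt (norm_discCoord_lt_one ϱ hzU.1)
    have h3 := conj_eq_sub_im ϱ
    have hη : (ϱ.im : ℂ) ≠ 0 := by exact_mod_cast ϱ.im_pos.ne'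
    have h2 : 1 - ellX ϱ z = (ϱ - q) / (z - q) := by
      rw [ellX, eq_div_iff hne, sub_mul, div_mul_cancel₀ _ hne]; ring
    have h4 : (ϱ : ℂ) - q ≠ 0 := sub_conj_ne_zero ϱ ϱ.im_pos
    simp only [φ, discInv]
    rw [h2, ellX, div_eq_iff (div_ne_zero h4 hne)]
    field_simp
    ring
  simp only [H, hφz, f, Function.comp_apply, UpperHalfPlane.ofComplex_apply]
  have : ((z : ℂ) - q) ^ (2 * k - 2) ≠ 0 := pow_ne_zero _ hne
  field_simp
  ring

end PolarMaass

theorem proposition2p3 (k : ℕ) (hk : 1 ≤ k) (ϱ : ℍ) (n₀ : ℕ) (R : ℝ) (hR : 0 < R) (F : ℍ → ℂ)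
    (hF : PolarMaass.IsHarmonicOn (1 - (k : ℤ)) F (PolarMaass.puncturedDisc ϱ R))
    (hbdd : (fun z : ℍ => (PolarMaass.ellR ϱ z : ℂ) ^ n₀ * F z) =O[𝓝[≠] ϱ] (fun _ => (1 : ℝ))) :
    (∃ cPlus cMinus : ℤ → ℂ, PolarMaass.HasEllipticExpansion k n₀ ϱ R F cPlus cMinus) ∧
    ∀ cPlus cMinus : ℤ → ℂ, PolarMaass.HasEllipticExpansion k n₀ ϱ R F cPlus cMinus →
      ∀ z ∈ PolarMaass.puncturedDisc ϱ R,
        ContDiffAt ℝ ∞ (F ∘ UpperHalfPlane.ofComplex) (z : ℂ) ∧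
        (Summable (fun n : Set.Iic (n₀ : ℤ) =>
            conj (cMinus n) * PolarMaass.ellX ϱ z ^ (-(n : ℤ) - 1)) ∧
          PolarMaass.xi (1 - (k : ℤ)) F z =
            (4 * (ϱ.im : ℂ)) ^ (2 * k - 1) * ((z : ℂ) - conj (ϱ : ℂ)) ^ (-(2 * (k : ℤ))) *
              ∑' n : Set.Iic (n₀ : ℤ),
                conj (cMinus n) * PolarMaass.ellX ϱ z ^ (-(n : ℤ) - 1)) ∧
        (Summable (fun n : Set.Ici (-(n₀ : ℤ)) =>
            PolarMaass.bCoeff k n₀ cPlus cMinus n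
              * PolarMaass.ellX ϱ z ^ ((n : ℤ) + 1 - 2 * (k : ℤ))) ∧
          PolarMaass.iterD (2 * k - 1) F z =
            ((ϱ.im : ℂ) / (Real.pi : ℂ)) ^ (2 * k - 1)
              * ((z : ℂ) - conj (ϱ : ℂ)) ^ (-(2 * (k : ℤ))) *
              ∑' n : Set.Ici (-(n₀ : ℤ)),
                PolarMaass.bCoeff k n₀ cPlus cMinus n
                  * PolarMaass.ellX ϱ z ^ ((n : ℤ) + 1 - 2 * (k : ℤ))) := by
  refine ⟨PolarMaass.exists_ellipticExpansion hk ϱ n₀ hR hF hbdd, fun cPlus cMinus h z hz => ?_⟩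
  have hzU := PolarMaass.coe_mem_coePuncturedDisc.2 hz
  have hw := PolarMaass.ellX_mem_annulus hz
  have hD := h.hasSum_iterate_dz hk hw
  refine ⟨(h.contDiffOn_coe hk).contDiffAt
    ((PolarMaass.isOpen_coePuncturedDisc ϱ R).mem_nhds hzU),
    ⟨(h.summableIic hk).summable_xiSeries hw, h.xi_eq hk hz⟩, ⟨hD.summable, ?_⟩⟩
  rw [h.iterD_eq hk hz, ← hD.tsum_eq]
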